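/- Let $d\ge 1$, $0<\alpha<d$, let $\Omega\subset\mathbb R^d$ be an open set (in particular, any domain) of finite Lebesgue measure $|\Omega|$, and let $K:\mathbb R^d\to\mathbb C$ be a function defining a tempered distribution whose Fourier transform $\widehat K(\xi)=\int_{\mathbb R^d}e^{-ix\cdot\xi}K(x)\,dx$, in the sense of tempered distributions, is $\widehat K(\xi)=|\xi|^{-\alpha}$. Then the integral operator $$\mathcal K u(x)=\int_\Omega K(x-y)\,u(y)\,dy$$ is a well-defined (the integral converges absolutely for a.e. $x\in\Omega$) compact self-adjoint operator on $L^2(\Omega)$, and $\mathcal K\ge 0$. In particular all its eigenvalues $\lambda_k$ are real and nonnegative. Moreover, for every $\lambda>0$, the number of eigenvalues greater than $\lambda$, counted with multiplicity, satisfies $$n(\lambda)=\#\{k:\lambda_k>\lambda\}\le (2\pi)^{-d}\,\lambda^{-d/\alpha}\,|\Omega|\,|\mathbb S^{d-1}|\,\frac{d^{d/\alpha}}{d\,(d-\alpha)^{d/\alpha}},$$ where $|\mathbb S^{d-1}|$ is the surface measure of the unit sphere in $\mathbb R^d$ (so $|\mathbb S^0|=2$). -/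

import Mathlib

open MeasureTheory
open scoped SchwartzMap ENNReal

noncomputable section

/-- The Fourier transform `φ̂(ξ) = ∫ e^{-i x·ξ} φ(x) dx` of a Schwartz function
(no `2π` in the exponent). -/
def fourierHat {d : ℕ} (φ : 𝓢(EuclideanSpace ℝ (Fin d), ℂ)) (ξ : EuclideanSpace ℝ (Fin d)) : ℂ :=
  ∫ x, Complex.exp (-(Complex.I * ((inner ℝ x ξ : ℝ) : ℂ))) * φ x

/-- The function `K` defines a tempered distribution, and so does the function `m`, and
`K̂ = m` in the sense of tempered distributions: `⟨K, φ̂⟩ = ⟨m, φ⟩` for every Schwartz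
function `φ`. -/
structure HasDistribFourier {d : ℕ} (K m : EuclideanSpace ℝ (Fin d) → ℂ) : Prop where
  integrable_left : ∀ φ : 𝓢(EuclideanSpace ℝ (Fin d), ℂ), Integrable (fun x => K x * φ x)
  integrable_right : ∀ φ : 𝓢(EuclideanSpace ℝ (Fin d), ℂ), Integrable (fun ξ => m ξ * φ ξ)
  pairing : ∀ φ : 𝓢(EuclideanSpace ℝ (Fin d), ℂ),
    ∫ x, K x * fourierHat φ x = ∫ ξ, m ξ * φ ξ

/-- The complex Hilbert space `L²(Ω)`, with Lebesgue measure on `Ω`. -/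
abbrev L2 {d : ℕ} (Ω : Set (EuclideanSpace ℝ (Fin d))) : Type :=
  Lp ℂ 2 (volume.restrict Ω)

/-- The bounded operator `T` on `L²(Ω)` is the integral operator
`(T u)(x) = ∫_Ω K(x - y) u(y) dy`, the integral being absolutely convergent for almost every
`x ∈ Ω`. There is at most one such `T`. -/
def IsConvolutionOperator {d : ℕ} (K : EuclideanSpace ℝ (Fin d) → ℂ)
    (Ω : Set (EuclideanSpace ℝ (Fin d))) (T : L2 Ω →L[ℂ] L2 Ω) : Prop :=
  ∀ u : L2 Ω, ∀ᵐ x ∂(volume.restrict Ω),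
    IntegrableOn (fun y => K (x - y) * u y) Ω ∧ T u x = ∫ y in Ω, K (x - y) * u y

/-- The number of eigenvalues of `T` in `(s, ∞)`, counted with multiplicity: the sum over all
real `μ > s` of the dimension of the eigenspace of `T` at `μ` (which is `0` when `μ` is not an
eigenvalue, and `∞` when the eigenspace is infinite-dimensional). -/
def eigenvalueCount {H : Type*} [NormedAddCommGroup H] [InnerProductSpace ℂ H]
    (T : H →L[ℂ] H) (s : ℝ) : ℝ≥0∞ :=
  ∑' μ : Set.Ioi s,
    ((Cardinal.toENat (Module.rank ℂ
      (Module.End.eigenspace (T : H →ₗ[ℂ] H) ((μ : ℝ) : ℂ))) : ℕ∞) : ℝ≥0∞)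

end

/-! This is the Berezin–Li–Yau argument: bound traces over orthonormal families in phase space. A
function with Fourier transform `|ξ|^{-α}` agrees a.e. with the Riesz kernel, a superposition of
heat kernels with weight `t^{α/2-1} dt / Γ(α/2)` (`HasDistribFourier.ae_eq_rieszKernel`). Tonelli
and Fubini thereby reduce each Fourier identity to one for Gaussians, and Schur's test gives the
operator `T`.

Its form is `⟨Tu, u⟩ = (2π)^{-d} ∫ |ξ|^{-α} |û(ξ)|² dξ`, with `u` extended by zero
(`rieszKernel_form`), so `T ≥ 0`. For orthonormal `v₁, …, vₙ` in `L²(Ω)`, Plancherel gives `∫ |v̂ᵢ|²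
≤ (2π)^d` and Bessel gives `∑ |v̂ᵢ(ξ)|² ≤ |Ω|` for each `ξ`. Splitting `|ξ|^{-α} ≤ R^{-α} +
(|ξ|^{-α} - R^{-α})₊`, with Plancherel on the first term and Bessel on the second, yields
(`sum_form_le`) `∑ ⟨Tvᵢ, vᵢ⟩ ≤ n R^{-α} + (2π)^{-d} |Ω| ∫_{|ξ|<R} (|ξ|^{-α} - R^{-α}) dξ`.

The last term does not depend on `n`. As `R^{-α}` can be arbitrarily small, `T` is compact
(`isCompactOperator_of_sum_re_inner_le`). If the `vᵢ` are eigenvectors with eigenvalues above `λ`,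
the left side is at least `nλ`; solving for `n` and optimizing `R` gives the stated constant
(`le_of_trace_bound`). -/

/-! ### Compactness and eigenvalue counting from partial traces. -/

section HilbertSpace

variable {H : Type*} [NormedAddCommGroup H] [InnerProductSpace ℂ H]

/-- If the quadratic form of a positive operator is at most `ε` times the square of the norm, then
so is its norm. -/
theorem ContinuousLinearMap.IsPositive.norm_le_of_re_inner_le {T : H →L[ℂ] H} (hT : T.IsPositive)
    {ε : ℝ} (hε : 0 ≤ ε) (h : ∀ u, (inner ℂ (T u) u).re ≤ ε * ‖u‖ ^ 2) : ‖T‖ ≤ ε := by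
  rw [T.norm_eq_iSup_rayleighQuotient hT.isSymmetric]
  refine Real.iSup_le (fun x => ?_) hε
  have h0 : 0 ≤ T.reApplyInnerSelf x := hT.re_inner_nonneg_left x
  have h1 : T.reApplyInnerSelf x ≤ ε * ‖x‖ ^ 2 := h x
  rw [ContinuousLinearMap.rayleighQuotient, abs_of_nonneg (by positivity)]
  exact div_le_of_le_mul₀ (by positivity) hε h1

theorem isCompactOperator_starProjection (V : Submodule ℂ H) [FiniteDimensional ℂ V] :
    IsCompactOperator V.starProjection :=
  have : ProperSpace V := FiniteDimensional.proper ℂ V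
  have h : IsCompactOperator V.subtypeL :=
    isCompactOperator_of_locallyCompactSpace_rng V.subtypeL
  h.comp_clm V.orthogonalProjectionOnto

/-- A positive operator is compact as soon as, for every `s > 0`, its partial traces along
orthonormal families of length `n` are at most `n * s + O(1)`. -/
theorem isCompactOperator_of_sum_re_inner_le [CompleteSpace H] {T : H →L[ℂ] H}
    (hT : T.IsPositive)
    (h : ∀ s : ℝ, 0 < s → ∃ C : ℝ, ∀ (n : ℕ) (v : Fin n → H), Orthonormal ℂ v →
      ∑ i, (inner ℂ (T (v i)) (v i)).re ≤ n * s + C) : IsCompactOperator T := by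
  refine (isClosed_setOfPred_isCompactOperator (σ₁₂ := RingHom.id ℂ)).closure_subset
    (Metric.mem_closure_iff.2 fun ε hε => ?_)
  -- The slope `ε / 4` lies below the threshold `ε / 2` in `P`, so `n ε/2 ≤ n ε/4 + C` bounds every
  -- `n` with `P n`. A family that cannot be lengthened then spans a subspace off which the form is
  -- below `ε / 2`.
  obtain ⟨C, hC⟩ := h (ε / 4) (by positivity)
  let P : ℕ → Prop := fun n => ∃ v : Fin n → H, Orthonormal ℂ v ∧
    ∀ i, ε / 2 ≤ (inner ℂ (T (v i)) (v i)).re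
  have hP0 : P 0 := ⟨Fin.elim0, ⟨fun i => i.elim0, fun i => i.elim0⟩, fun i => i.elim0⟩
  have hPb : ∀ n, P n → n ≤ ⌈4 * C / ε⌉₊ := by
    rintro n ⟨v, hv, hvi⟩
    have h1 := hC n v hv
    have h2 : (n : ℝ) * (ε / 2) ≤ ∑ i, (inner ℂ (T (v i)) (v i)).re := by
      simpa using Finset.sum_le_sum fun i (_ : i ∈ Finset.univ) => hvi i
    have h3 : (n : ℝ) ≤ 4 * C / ε := by
      rw [le_div_iff₀ hε]
      linarith
    exact_mod_cast h3.trans (Nat.le_ceil _)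
  obtain ⟨n, ⟨v, hv, hvi⟩, hmax⟩ : ∃ n, P n ∧ ¬ P (n + 1) := by
    by_contra! hall
    have hPall : ∀ n, P n := fun n => Nat.rec hP0 hall n
    exact absurd (hPb _ (hPall (⌈4 * C / ε⌉₊ + 1))) (by omega)
  let V : Submodule ℂ H := Submodule.span ℂ (Set.range v)
  have hVfin : FiniteDimensional ℂ V := FiniteDimensional.span_of_finite ℂ (Set.finite_range v)
  have hunit : ∀ u ∈ Vᗮ, ‖u‖ = 1 → (inner ℂ (T u) u).re < ε / 2 := by
    intro u hu hu1
    by_contra! hlt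
    have : P (n + 1) := by
      refine ⟨Matrix.vecCons u v, orthonormal_vecCons_iff.2 ⟨hu1, fun i => ?_, hv⟩, ?_⟩
      · exact (Submodule.mem_orthogonal' V u).1 hu _ (Submodule.subset_span ⟨i, rfl⟩)
      · exact Fin.cases hlt hvi
    exact hmax this
  have hform : ∀ u ∈ Vᗮ, (inner ℂ (T u) u).re ≤ ε / 2 * ‖u‖ ^ 2 := by
    intro u hu
    rcases eq_or_ne u 0 with rfl | hu0
    · simp
    have hnu : ‖u‖ ≠ 0 := norm_ne_zero_iff.2 hu0
    have h1 := hunit (((‖u‖⁻¹ : ℝ) : ℂ) • u) (Vᗮ.smul_mem _ hu) (by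
      rw [norm_smul, Complex.norm_real, norm_inv, norm_norm, inv_mul_cancel₀ hnu])
    rw [map_smul, inner_smul_left, inner_smul_right, Complex.conj_ofReal, Complex.re_ofReal_mul,
      Complex.re_ofReal_mul, ← mul_assoc, ← pow_two, inv_pow, inv_mul_lt_iff₀ (by positivity)] at h1
    linarith
  let Q := Vᗮ.starProjection
  let R := V.starProjection
  have hQR : ∀ u, Q u = u - R u := fun u => by
    rw [eq_sub_iff_add_eq, add_comm]
    exact Submodule.starProjection_add_starProjection_orthogonal (K := V) u
  have hS : (Q ∘L T ∘L Q).IsPositive := hT.conj_starProjection Vᗮ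
  have hSn : ‖Q ∘L T ∘L Q‖ ≤ ε / 2 := by
    refine hS.norm_le_of_re_inner_le (by positivity) fun u => ?_
    have h1 : inner ℂ ((Q ∘L T ∘L Q) u) u = inner ℂ (T (Q u)) (Q u) := by
      exact Submodule.inner_starProjection_left_eq_right Vᗮ _ _
    rw [h1]
    refine (hform _ (Submodule.starProjection_apply_mem _ _)).trans ?_
    gcongr
    exact (Q.le_opNorm u).trans
      (mul_le_of_le_one_left (norm_nonneg u) (Submodule.starProjection_norm_le Vᗮ))
  -- Both summands have finite rank, and with `Q + R = 1` the error is the compression `Q T Q`,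
  -- already bounded by `ε / 2`.
  refine ⟨R ∘L T + Q ∘L T ∘L R, ?_, ?_⟩
  · have hR : IsCompactOperator R := isCompactOperator_starProjection V
    exact (hR.comp_clm T).add (hR.clm_comp (Q ∘L T))
  · have h1 : T - (R ∘L T + Q ∘L T ∘L R) = Q ∘L T ∘L Q := by
      ext u
      simp only [sub_apply, add_apply,
        ContinuousLinearMap.comp_apply, hQR, map_sub]
      abel
    rw [dist_eq_norm, h1]
    linarith

/-- The eigenvalue count of a compact positive operator is bounded by every bound for the lengths
of orthonormal families of eigenvectors with eigenvalues above the threshold. -/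
theorem eigenvalueCount_le_ofReal [CompleteSpace H] {T : H →L[ℂ] H} (hT : T.IsPositive)
    (hc : IsCompactOperator T) {s : ℝ} (hs : 0 < s) {B : ℝ}
    (h : ∀ (n : ℕ) (v : Fin n → H), Orthonormal ℂ v →
      (∀ i, s ≤ (inner ℂ (T (v i)) (v i)).re) → n ≤ B) :
    eigenvalueCount T s ≤ ENNReal.ofReal B := by
  rw [eigenvalueCount, ENNReal.tsum_eq_iSup_sum]
  refine iSup_le fun F => ?_
  let W : F → Submodule ℂ H := fun μ =>
    Module.End.eigenspace (T : H →ₗ[ℂ] H) (((μ : Set.Ioi s) : ℝ) : ℂ)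
  -- Compactness makes eigenspaces at nonzero eigenvalues finite-dimensional, so the extended ranks
  -- in the count are natural numbers. Orthonormal bases of the orthogonal eigenspaces then combine
  -- into a single family for `h`.
  have hfd : ∀ μ : F, FiniteDimensional ℂ (W μ) := fun μ => by
    refine ContinuousLinearMap.finite_dimensional_eigenspace hc _ ?_
    have : (0 : ℝ) < ((μ : Set.Ioi s) : ℝ) := hs.trans (μ : Set.Ioi s).2
    exact_mod_cast this.ne'
  have hsum : ∑ μ ∈ F, ((Cardinal.toENat (Module.rank ℂ
      (Module.End.eigenspace (T : H →ₗ[ℂ] H) ((μ : ℝ) : ℂ))) : ℕ∞) : ℝ≥0∞) =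
      ((∑ μ : F, Module.finrank ℂ (W μ) : ℕ) : ℝ≥0∞) := by
    rw [← Finset.sum_coe_sort, Nat.cast_sum]
    refine Finset.sum_congr rfl fun μ _ => ?_
    change ((Cardinal.toENat (Module.rank ℂ (W μ)) : ℕ∞) : ℝ≥0∞) = _
    rw [← Module.finrank_eq_rank ℂ (W μ), Cardinal.toENat_nat]
    rfl
  have horth : OrthogonalFamily ℂ (fun μ : F => W μ) fun μ => (W μ).subtypeₗᵢ :=
    (hT.isSymmetric.orthogonalFamily_eigenspaces).comp
      (f := fun μ : F => (((μ : Set.Ioi s) : ℝ) : ℂ))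
      (Complex.ofReal_injective.comp (Subtype.val_injective.comp Subtype.val_injective))
  let w : (Σ μ : F, Fin (Module.finrank ℂ (W μ))) → H :=
    fun a => (stdOrthonormalBasis ℂ (W a.1) a.2 : H)
  have hw : Orthonormal ℂ w :=
    horth.orthonormal_sigma_orthonormal fun μ => (stdOrthonormalBasis ℂ (W μ)).orthonormal
  let e := (Fintype.equivFin (Σ μ : F, Fin (Module.finrank ℂ (W μ)))).symm
  have hle := h _ (w ∘ e) (hw.comp e e.injective) fun i => by
    have hmem : w (e i) ∈ W (e i).1 := (stdOrthonormalBasis ℂ (W (e i).1) (e i).2).2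
    have heig := Module.End.mem_eigenspace_iff.1 hmem
    have heig' : T (w (e i)) = ((((e i).1 : Set.Ioi s) : ℝ) : ℂ) • w (e i) := heig
    rw [Function.comp_apply, heig', inner_smul_left, Complex.conj_ofReal,
      inner_self_eq_norm_sq_to_K, hw.1 (e i)]
    simpa using (((e i).1 : Set.Ioi s).2 : s < _).le
  rw [hsum]
  rw [Fintype.card_sigma] at hle
  simp only [Fintype.card_fin] at hle
  rw [← ENNReal.ofReal_natCast]
  exact ENNReal.ofReal_le_ofReal hle

end HilbertSpace

/-! ### Schur's test and operators with real symmetric kernels. -/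

section SchurTest

open scoped NNReal ComplexConjugate

variable {X : Type*} [MeasurableSpace X] {μ : Measure X} [SFinite μ]

theorem enorm_ofReal (r : ℝ) : ‖(r : ℂ)‖ₑ = ‖r‖ₑ := by
  simp [enorm_eq_nnnorm]

omit [SFinite μ] in
-- Cauchy–Schwarz applied to `k f = √k · (√k f)`.
theorem lintegral_mul_sq_le {k f : X → ℝ≥0∞} (hk : AEMeasurable k μ) (hf : AEMeasurable f μ) :
    (∫⁻ y, k y * f y ∂μ) ^ 2 ≤ (∫⁻ y, k y ∂μ) * ∫⁻ y, k y * f y ^ 2 ∂μ := by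
  have hs : ∀ a : ℝ≥0∞, (a ^ (1 / 2 : ℝ)) ^ 2 = a := fun a => by
    rw [← ENNReal.rpow_natCast, ← ENNReal.rpow_mul]
    norm_num
  have hss : ∀ a : ℝ≥0∞, a ^ (1 / 2 : ℝ) * a ^ (1 / 2 : ℝ) = a := fun a => by
    rw [← pow_two, hs]
  have h := ENNReal.lintegral_mul_le_Lp_mul_Lq μ Real.HolderConjugate.two_two
    (hk.pow_const (1 / 2 : ℝ)) ((hk.pow_const (1 / 2 : ℝ)).mul hf)
  simp only [Pi.mul_apply, ← mul_assoc, hss, ENNReal.rpow_two, mul_pow, hs] at h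
  refine (pow_le_pow_left' h 2).trans (le_of_eq ?_)
  rw [mul_pow, hs, hs]

variable {k : X → X → ℝ≥0∞} {M : ℝ≥0}

/-- Schur's test. -/
theorem lintegral_lintegral_mul_sq_le (hk : Measurable (Function.uncurry k))
    (hsymm : ∀ x y, k x y = k y x) (hM : ∀ x, ∫⁻ y, k x y ∂μ ≤ M) {f : X → ℝ≥0∞}
    (hf : Measurable f) :
    ∫⁻ x, (∫⁻ y, k x y * f y ∂μ) ^ 2 ∂μ ≤ (M : ℝ≥0∞) ^ 2 * ∫⁻ y, f y ^ 2 ∂μ := by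
  have hkx : ∀ x, Measurable (k x) := fun x => hk.of_uncurry_left
  calc ∫⁻ x, (∫⁻ y, k x y * f y ∂μ) ^ 2 ∂μ
      ≤ ∫⁻ x, M * ∫⁻ y, k x y * f y ^ 2 ∂μ ∂μ := by
        refine lintegral_mono fun x => ?_
        exact (lintegral_mul_sq_le (hkx x).aemeasurable hf.aemeasurable).trans
          (mul_le_mul_left (hM x) _)
    _ = M * ∫⁻ y, ∫⁻ x, k x y * f y ^ 2 ∂μ ∂μ := by
        rw [lintegral_const_mul' _ _ ENNReal.coe_ne_top, lintegral_lintegral_swap]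
        exact (hk.mul ((hf.comp measurable_snd).pow_const 2)).aemeasurable
    _ ≤ M * ∫⁻ y, M * f y ^ 2 ∂μ := by
        gcongr with y
        rw [lintegral_mul_const _ (by simpa only [hsymm _ y] using hkx y)]
        gcongr
        simpa only [hsymm _ y] using hM y
    _ = _ := by rw [lintegral_const_mul' _ _ ENNReal.coe_ne_top, ← mul_assoc, pow_two]

/-- Comes from `ab ≤ a² + b²` and the symmetry of `k`. Only finiteness is needed later, to justify
Fubini for quadratic forms, so the factor 2 is harmless. -/
theorem lintegral_lintegral_mul_mul_le (hk : Measurable (Function.uncurry k))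
    (hsymm : ∀ x y, k x y = k y x) (hM : ∀ x, ∫⁻ y, k x y ∂μ ≤ M) {f : X → ℝ≥0∞}
    (hf : Measurable f) :
    ∫⁻ x, ∫⁻ y, k x y * f y * f x ∂μ ∂μ ≤ 2 * M * ∫⁻ y, f y ^ 2 ∂μ := by
  have hkx : ∀ x, Measurable (k x) := fun x => hk.of_uncurry_left
  have hab : ∀ a b : ℝ≥0∞, a * b ≤ a ^ 2 + b ^ 2 := fun a b => by
    rcases le_total a b with h | h
    · exact (mul_le_mul_left h b).trans (by rw [← pow_two]; exact le_add_self)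
    · exact (mul_le_mul_right h a).trans (by rw [← pow_two]; exact le_self_add)
  have hone : ∫⁻ x, ∫⁻ y, k x y * f x ^ 2 ∂μ ∂μ ≤ M * ∫⁻ y, f y ^ 2 ∂μ := by
    rw [← lintegral_const_mul' _ _ ENNReal.coe_ne_top]
    refine lintegral_mono fun x => ?_
    simp only
    rw [lintegral_mul_const _ (hkx x)]
    gcongr
    exact hM x
  have htwo : ∫⁻ x, ∫⁻ y, k x y * f y ^ 2 ∂μ ∂μ = ∫⁻ x, ∫⁻ y, k x y * f x ^ 2 ∂μ ∂μ := by
    rw [lintegral_lintegral_swap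
      (hk.mul ((hf.comp measurable_snd).pow_const 2)).aemeasurable]
    simp only [hsymm]
  calc ∫⁻ x, ∫⁻ y, k x y * f y * f x ∂μ ∂μ
      ≤ ∫⁻ x, (∫⁻ y, k x y * f y ^ 2 ∂μ + ∫⁻ y, k x y * f x ^ 2 ∂μ) ∂μ := by
        refine lintegral_mono fun x => ?_
        rw [← lintegral_add_left (by exact (hkx x).mul (hf.pow_const 2))]
        refine lintegral_mono fun y => ?_
        simp only
        rw [mul_assoc, ← mul_add]
        gcongr
        exact hab _ _
    _ = ∫⁻ x, ∫⁻ y, k x y * f y ^ 2 ∂μ ∂μ + ∫⁻ x, ∫⁻ y, k x y * f x ^ 2 ∂μ ∂μ := by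
        rw [lintegral_add_left]
        exact (hk.mul ((hf.comp measurable_snd).pow_const 2)).lintegral_prod_right'
    _ ≤ _ := by
        rw [htwo, ← two_mul, mul_assoc]
        gcongr

omit [SFinite μ] in
theorem eLpNorm_two_sq_eq_lintegral (f : X → ℂ) :
    eLpNorm f 2 μ ^ 2 = ∫⁻ x, ‖f x‖ₑ ^ 2 ∂μ := by
  have h := eLpNorm_nnreal_pow_eq_lintegral (μ := μ) (f := f) (p := 2) two_ne_zero
  simpa [ENNReal.rpow_two] using h

variable {κ : X → X → ℝ}

omit [SFinite μ] in
theorem lintegral_enorm_sq_Lp_lt_top (u : Lp ℂ 2 μ) : ∫⁻ x, ‖u x‖ₑ ^ 2 ∂μ < ∞ := by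
  rw [← eLpNorm_two_sq_eq_lintegral]
  exact ENNReal.pow_lt_top (Lp.eLpNorm_lt_top u)

/-- Schur's test applied to absolute values shows that `x ↦ ∫ |κ x y| |u y|` is square integrable,
hence finite almost everywhere. -/
theorem integrable_kernel_mul (hκ : Measurable (Function.uncurry κ))
    (hsymm : ∀ x y, κ x y = κ y x) (hM : ∀ x, ∫⁻ y, ‖κ x y‖ₑ ∂μ ≤ M) (u : Lp ℂ 2 μ) :
    ∀ᵐ x ∂μ, Integrable (fun y => (κ x y : ℂ) * u y) μ := by
  have hu : Measurable u := (Lp.stronglyMeasurable u).measurable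
  have hke : Measurable (Function.uncurry fun x y => ‖κ x y‖ₑ) := hκ.enorm
  have h := lintegral_lintegral_mul_sq_le hke (fun x y => by rw [hsymm]) hM hu.enorm
  have hfin := h.trans_lt (ENNReal.mul_lt_top (by simp) (lintegral_enorm_sq_Lp_lt_top u))
  have hmeas : Measurable fun x => ∫⁻ y, ‖κ x y‖ₑ * ‖u y‖ₑ ∂μ :=
    (hke.mul (hu.enorm.comp measurable_snd)).lintegral_prod_right'
  filter_upwards [ae_lt_top (hmeas.pow_const 2) hfin.ne] with x hx
  refine ⟨((Complex.measurable_ofReal.comp hκ.of_uncurry_left).mul hu).aestronglyMeasurable, ?_⟩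
  rw [HasFiniteIntegral]
  have := (ENNReal.pow_lt_top_iff.1 hx).resolve_right two_ne_zero
  simpa [enorm_mul, enorm_ofReal] using this

theorem eLpNorm_integral_kernel_mul_le (hκ : Measurable (Function.uncurry κ))
    (hsymm : ∀ x y, κ x y = κ y x) (hM : ∀ x, ∫⁻ y, ‖κ x y‖ₑ ∂μ ≤ M) (u : Lp ℂ 2 μ) :
    eLpNorm (fun x => ∫ y, (κ x y : ℂ) * u y ∂μ) 2 μ ≤ M * eLpNorm u 2 μ := by
  have hu : Measurable u := (Lp.stronglyMeasurable u).measurable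
  have hke : Measurable (Function.uncurry fun x y => ‖κ x y‖ₑ) := hκ.enorm
  have h := lintegral_lintegral_mul_sq_le hke (fun x y => by rw [hsymm]) hM hu.enorm
  rw [← ENNReal.pow_le_pow_left_iff two_ne_zero, mul_pow,
    eLpNorm_two_sq_eq_lintegral, eLpNorm_two_sq_eq_lintegral]
  refine le_trans (lintegral_mono fun x => ?_) h
  gcongr
  refine (enorm_integral_le_lintegral_enorm _).trans (le_of_eq ?_)
  simp [enorm_mul, enorm_ofReal]

/-- The integral operator of a real symmetric kernel satisfying Schur's test. -/
theorem exists_kernelOperator (hκ : Measurable (Function.uncurry κ))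
    (hsymm : ∀ x y, κ x y = κ y x) (hM : ∀ x, ∫⁻ y, ‖κ x y‖ₑ ∂μ ≤ M) :
    ∃ T : Lp ℂ 2 μ →L[ℂ] Lp ℂ 2 μ, ‖T‖ ≤ M ∧ ∀ u : Lp ℂ 2 μ, ∀ᵐ x ∂μ,
      Integrable (fun y => (κ x y : ℂ) * u y) μ ∧ T u x = ∫ y, (κ x y : ℂ) * u y ∂μ := by
  have hmem : ∀ u : Lp ℂ 2 μ, MemLp (fun x => ∫ y, (κ x y : ℂ) * u y ∂μ) 2 μ := fun u => by
    refine ⟨?_, (eLpNorm_integral_kernel_mul_le hκ hsymm hM u).trans_lt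
      (ENNReal.mul_lt_top ENNReal.coe_lt_top (Lp.eLpNorm_lt_top u))⟩
    have hu : Measurable u := (Lp.stronglyMeasurable u).measurable
    have hm : StronglyMeasurable (fun p : X × X => (κ p.1 p.2 : ℂ) * u p.2) :=
      ((Complex.measurable_ofReal.comp hκ).mul (hu.comp measurable_snd)).stronglyMeasurable
    exact hm.integral_prod_right'.aestronglyMeasurable
  let L : Lp ℂ 2 μ →ₗ[ℂ] Lp ℂ 2 μ :=
    { toFun := fun u => (hmem u).toLp _
      map_add' := fun u v => by
        rw [← MemLp.toLp_add]
        refine MemLp.toLp_congr _ _ ?_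
        filter_upwards [integrable_kernel_mul hκ hsymm hM u,
          integrable_kernel_mul hκ hsymm hM v] with x hx hy
        rw [Pi.add_apply, ← integral_add hx hy]
        refine integral_congr_ae ?_
        filter_upwards [Lp.coeFn_add u v] with y hy
        rw [hy, Pi.add_apply, mul_add]
      map_smul' := fun c u => by
        rw [RingHom.id_apply, ← MemLp.toLp_const_smul]
        refine MemLp.toLp_congr _ _ (Filter.Eventually.of_forall fun x => ?_)
        simp only [Pi.smul_apply]
        rw [← integral_smul]
        refine integral_congr_ae ?_
        filter_upwards [Lp.coeFn_smul c u] with y hy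
        rw [hy, Pi.smul_apply, smul_eq_mul, smul_eq_mul, mul_left_comm] }
  have hL : ∀ u, ‖L u‖ ≤ M * ‖u‖ := fun u => by
    have h1 : ‖L u‖ = (eLpNorm (fun x => ∫ y, (κ x y : ℂ) * u y ∂μ) 2 μ).toReal :=
      Lp.norm_toLp _ (hmem u)
    rw [h1, Lp.norm_def, ← ENNReal.coe_toReal M, ← ENNReal.toReal_mul]
    exact ENNReal.toReal_mono (ENNReal.mul_ne_top ENNReal.coe_ne_top (Lp.eLpNorm_ne_top u))
      (eLpNorm_integral_kernel_mul_le hκ hsymm hM u)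
  refine ⟨L.mkContinuous M hL, L.mkContinuous_norm_le M.2 hL, fun u => ?_⟩
  filter_upwards [integrable_kernel_mul hκ hsymm hM u, (hmem u).coeFn_toLp] with x hx hy
  exact ⟨hx, hy⟩

theorem integrable_kernel_mul_conj_mul (hκ : Measurable (Function.uncurry κ))
    (hsymm : ∀ x y, κ x y = κ y x) (hM : ∀ x, ∫⁻ y, ‖κ x y‖ₑ ∂μ ≤ M) (u : Lp ℂ 2 μ) :
    Integrable (fun p : X × X => (κ p.1 p.2 : ℂ) * conj (u p.2) * u p.1) (μ.prod μ) := by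
  have hu : Measurable u := (Lp.stronglyMeasurable u).measurable
  have hke : Measurable (Function.uncurry fun x y => ‖κ x y‖ₑ) := hκ.enorm
  have hmeas : Measurable fun p : X × X => (κ p.1 p.2 : ℂ) * conj (u p.2) * u p.1 :=
    ((Complex.measurable_ofReal.comp hκ).mul
      (Complex.continuous_conj.measurable.comp (hu.comp measurable_snd))).mul
        (hu.comp measurable_fst)
  refine ⟨hmeas.aestronglyMeasurable, ?_⟩
  rw [HasFiniteIntegral, lintegral_prod _ hmeas.enorm.aemeasurable]
  have h := lintegral_lintegral_mul_mul_le hke (fun x y => by rw [hsymm]) hM hu.enorm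
  refine lt_of_le_of_lt ?_ (h.trans_lt (ENNReal.mul_lt_top (by finiteness)
    (lintegral_enorm_sq_Lp_lt_top u)))
  simp [enorm_mul, enorm_ofReal]

/-- The quadratic form of a kernel operator. -/
theorem inner_kernelOperator (hκ : Measurable (Function.uncurry κ))
    (hsymm : ∀ x y, κ x y = κ y x) (hM : ∀ x, ∫⁻ y, ‖κ x y‖ₑ ∂μ ≤ M)
    {T : Lp ℂ 2 μ →L[ℂ] Lp ℂ 2 μ} {u : Lp ℂ 2 μ}
    (hT : ∀ᵐ x ∂μ, T u x = ∫ y, (κ x y : ℂ) * u y ∂μ) :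
    inner ℂ (T u) u = ∫ p, (κ p.1 p.2 : ℂ) * conj (u p.2) * u p.1 ∂(μ.prod μ) := by
  rw [L2.inner_def, integral_prod _ (integrable_kernel_mul_conj_mul hκ hsymm hM u)]
  refine integral_congr_ae ?_
  filter_upwards [hT] with x hx
  rw [hx, RCLike.inner_apply, integral_mul_const, ← integral_conj, mul_comm]
  simp

end SchurTest

/-! ### Heat kernels and the Riesz kernel. -/

section RieszPotential

open Set
open scoped NNReal ComplexConjugate Real

variable {d : ℕ}

/-- The heat kernel `(4πt)^{-d/2} exp(-|x|²/(4t))`. -/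
noncomputable def heatKernel (t : ℝ) (x : EuclideanSpace ℝ (Fin d)) : ℝ :=
  (4 * π * t) ^ (-((d : ℝ) / 2)) * Real.exp (-(4 * t)⁻¹ * ‖x‖ ^ 2)

theorem measurable_heatKernel :
    Measurable fun p : ℝ × EuclideanSpace ℝ (Fin d) => heatKernel p.1 p.2 := by
  unfold heatKernel
  fun_prop

theorem heatKernel_nonneg {t : ℝ} (ht : 0 ≤ t) (x : EuclideanSpace ℝ (Fin d)) :
    0 ≤ heatKernel t x := by
  unfold heatKernel
  positivity

theorem heatKernel_le {t : ℝ} (ht : 0 ≤ t) (x : EuclideanSpace ℝ (Fin d)) :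
    heatKernel t x ≤ (4 * π * t) ^ (-((d : ℝ) / 2)) := by
  refine mul_le_of_le_one_right (by positivity) (Real.exp_le_one_iff.2 ?_)
  rw [neg_mul, neg_nonpos]
  positivity

theorem heatKernel_neg (t : ℝ) (x : EuclideanSpace ℝ (Fin d)) :
    heatKernel t (-x) = heatKernel t x := by
  simp [heatKernel]

theorem heatKernel_sub_comm (t : ℝ) (x y : EuclideanSpace ℝ (Fin d)) :
    heatKernel t (x - y) = heatKernel t (y - x) := by
  rw [← heatKernel_neg, neg_sub]

/-- The integral of a Gaussian against a character. -/
theorem integral_gaussian_mul_exp {b : ℝ} (hb : 0 < b) (ξ : EuclideanSpace ℝ (Fin d)) :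
    ∫ x : EuclideanSpace ℝ (Fin d), Complex.exp (-(Complex.I * ((inner ℝ x ξ : ℝ) : ℂ))) *
      ((Real.exp (-b * ‖x‖ ^ 2) : ℝ) : ℂ) =
      (((π / b) ^ ((d : ℝ) / 2) * Real.exp (-(4 * b)⁻¹ * ‖ξ‖ ^ 2) : ℝ) : ℂ) := by
  have h := GaussianFourier.integral_cexp_neg_mul_sq_norm_add (b := (b : ℂ)) (by simpa using hb)
    (-Complex.I) ξ
  have h1 : ((π : ℂ) / b) ^ ((Module.finrank ℝ (EuclideanSpace ℝ (Fin d)) : ℂ) / 2) =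
      (((π / b) ^ ((d : ℝ) / 2) : ℝ) : ℂ) := by
    rw [Complex.ofReal_cpow (by positivity)]
    simp
  have h2 : Complex.exp ((-Complex.I) ^ 2 * ‖ξ‖ ^ 2 / (4 * b)) =
      ((Real.exp (-(4 * b)⁻¹ * ‖ξ‖ ^ 2) : ℝ) : ℂ) := by
    rw [Complex.ofReal_exp]
    congr 1
    rw [neg_sq, Complex.I_sq]
    push_cast
    field_simp
  rw [h1, h2, ← Complex.ofReal_mul] at h
  rw [← h]
  refine integral_congr_ae (Filter.Eventually.of_forall fun x => ?_)
  simp only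
  rw [Complex.ofReal_exp, ← Complex.exp_add, real_inner_comm]
  congr 1
  push_cast
  ring

theorem integrable_gaussian {b : ℝ} (hb : 0 < b) :
    Integrable fun x : EuclideanSpace ℝ (Fin d) => Real.exp (-b * ‖x‖ ^ 2) := by
  have h := (GaussianFourier.integrable_cexp_neg_mul_sq_norm_add (b := (b : ℂ))
    (by simpa using hb) 0 (0 : EuclideanSpace ℝ (Fin d))).norm
  refine h.congr (Filter.Eventually.of_forall fun x => ?_)
  simp only [zero_mul, add_zero, Complex.norm_exp]
  norm_cast

theorem integrable_heatKernel {t : ℝ} (ht : 0 < t) :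
    Integrable fun x : EuclideanSpace ℝ (Fin d) => heatKernel t x :=
  (integrable_gaussian (by positivity)).const_mul _

theorem integral_exp_mul_heatKernel {t : ℝ} (ht : 0 < t) (ξ : EuclideanSpace ℝ (Fin d)) :
    ∫ x : EuclideanSpace ℝ (Fin d), Complex.exp (-(Complex.I * ((inner ℝ x ξ : ℝ) : ℂ))) *
      (heatKernel t x : ℂ) = ((Real.exp (-t * ‖ξ‖ ^ 2) : ℝ) : ℂ) := by
  have h := integral_gaussian_mul_exp (b := (4 * t)⁻¹) (by positivity) ξ
  simp only [heatKernel, Complex.ofReal_mul,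
    mul_left_comm _ ((((4 * π * t) ^ (-((d : ℝ) / 2)) : ℝ)) : ℂ)]
  rw [integral_const_mul, h, ← Complex.ofReal_mul, ← mul_assoc,
    show π / (4 * t)⁻¹ = 4 * π * t by field_simp, ← Real.rpow_add (by positivity)]
  congr 1
  rw [neg_add_cancel, Real.rpow_zero, one_mul]
  congr 3
  field_simp

/-- The inverse direction: writing the heat kernel as an integral of characters is what diagonalizes
its quadratic form. -/
theorem integral_exp_mul_exp_neg {t : ℝ} (ht : 0 < t) (x : EuclideanSpace ℝ (Fin d)) :
    ∫ ξ : EuclideanSpace ℝ (Fin d), Complex.exp (-(Complex.I * ((inner ℝ ξ x : ℝ) : ℂ))) *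
      ((Real.exp (-t * ‖ξ‖ ^ 2) : ℝ) : ℂ) = (((2 * π) ^ (d : ℝ) * heatKernel t x : ℝ) : ℂ) := by
  rw [integral_gaussian_mul_exp ht, heatKernel, ← mul_assoc]
  congr 3
  rw [Real.rpow_neg (by positivity), ← Real.inv_rpow (by positivity),
    show (2 * π) ^ (d : ℝ) = ((2 * π) ^ 2) ^ ((d : ℝ) / 2) by
      rw [← Real.rpow_two, ← Real.rpow_mul (by positivity), mul_div_cancel₀ _ two_ne_zero],
    ← Real.mul_rpow (by positivity) (by positivity)]
  congr 1
  field_simp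
  norm_num

theorem lintegral_heatKernel {t : ℝ} (ht : 0 < t) :
    ∫⁻ x : EuclideanSpace ℝ (Fin d), ENNReal.ofReal (heatKernel t x) = 1 := by
  rw [← ofReal_integral_eq_lintegral_ofReal (integrable_heatKernel ht)
    (Filter.Eventually.of_forall (heatKernel_nonneg ht.le))]
  -- The total mass is the Fourier transform at the origin.
  have h := integral_exp_mul_heatKernel ht (0 : EuclideanSpace ℝ (Fin d))
  simp only [inner_zero_right, Complex.ofReal_zero, mul_zero, neg_zero, Complex.exp_zero,
    one_mul, norm_zero, ne_eq, OfNat.ofNat_ne_zero, not_false_eq_true, zero_pow, Real.exp_zero,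
    Complex.ofReal_one, integral_complex_ofReal] at h
  have h' : ∫ x : EuclideanSpace ℝ (Fin d), heatKernel t x = 1 := by exact_mod_cast h
  rw [h', ENNReal.ofReal_one]

/-- The measure `t^{α/2-1} dt / Γ(α/2)` on the positive half-line, whose Laplace transform is
`s ↦ s^{-α/2}`. -/
noncomputable def powerMeasure (α : ℝ) : Measure ℝ :=
  (volume.restrict (Ioi 0)).withDensity fun t =>
    ENNReal.ofReal (t ^ (α / 2 - 1) / Real.Gamma (α / 2))

instance (α : ℝ) : SFinite (powerMeasure α) := by
  unfold powerMeasure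
  infer_instance

theorem measurable_powerMeasure_density (α : ℝ) :
    Measurable fun t : ℝ => ENNReal.ofReal (t ^ (α / 2 - 1) / Real.Gamma (α / 2)) := by
  fun_prop

theorem ae_powerMeasure_pos (α : ℝ) : ∀ᵐ t ∂(powerMeasure α), 0 < t :=
  (withDensity_absolutelyContinuous _ _).ae_le (ae_restrict_mem measurableSet_Ioi)

theorem lintegral_exp_neg_powerMeasure {α : ℝ} (hα : 0 < α) {s : ℝ} (hs : 0 < s) :
    ∫⁻ t, ENNReal.ofReal (Real.exp (-t * s)) ∂(powerMeasure α) =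
      ENNReal.ofReal (s ^ (-(α / 2))) := by
  have hΓ : 0 < Real.Gamma (α / 2) := Real.Gamma_pos_of_pos (by positivity)
  have h := Real.integral_rpow_mul_exp_neg_mul_Ioi (a := α / 2) (by positivity) hs
  have hpos : 0 < (1 / s) ^ (α / 2) * Real.Gamma (α / 2) := by positivity
  -- A non-integrable function would have Bochner integral 0, contradicting the positive value of
  -- the Gamma integral.
  have hint : IntegrableOn (fun t : ℝ => t ^ (α / 2 - 1) * Real.exp (-(s * t))) (Ioi 0) := by
    by_contra hn
    rw [integral_undef hn] at h
    exact hpos.ne h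
  rw [powerMeasure, lintegral_withDensity_eq_lintegral_mul _ (measurable_powerMeasure_density α)
    (by fun_prop)]
  have h2 : ∫⁻ t in Ioi (0 : ℝ), ((fun t : ℝ => ENNReal.ofReal (t ^ (α / 2 - 1) /
      Real.Gamma (α / 2))) * fun t => ENNReal.ofReal (Real.exp (-t * s))) t =
      ∫⁻ t in Ioi (0 : ℝ), ENNReal.ofReal (t ^ (α / 2 - 1) * Real.exp (-(s * t)) /
        Real.Gamma (α / 2)) := by
    refine setLIntegral_congr_fun measurableSet_Ioi fun t ht => ?_
    have ht' : (0 : ℝ) < t := ht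
    simp only [Pi.mul_apply]
    rw [← ENNReal.ofReal_mul (by positivity)]
    congr 1
    rw [show -t * s = -(s * t) by ring]
    ring
  rw [h2, ← ofReal_integral_eq_lintegral_ofReal (hint.div_const _)
    ((ae_restrict_iff' measurableSet_Ioi).2 (Filter.Eventually.of_forall fun t ht => by
      have ht' : (0 : ℝ) < t := ht
      positivity)), integral_div, h, mul_div_cancel_right₀ _ hΓ.ne', one_div,
    Real.inv_rpow hs.le, Real.rpow_neg hs.le]

/-- The condition `0 < α` is what makes `t^{α/2-1}` integrable at 0; dually, `α < d` makes
`t^{α/2-1-d/2}` integrable at infinity in the next lemma. -/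
theorem powerMeasure_Iio_one_lt_top {α : ℝ} (hα : 0 < α) : powerMeasure α (Iio 1) < ∞ := by
  rw [powerMeasure, withDensity_apply _ measurableSet_Iio, Measure.restrict_restrict
    measurableSet_Iio, Iio_inter_Ioi]
  have h : IntegrableOn (fun t : ℝ => t ^ (α / 2 - 1)) (Ioo 0 1) :=
    (intervalIntegral.integrableOn_Ioo_rpow_iff one_pos).2 (by linarith)
  exact (h.div_const _).lintegral_lt_top

theorem lintegral_Ici_one_powerMeasure_lt_top {α : ℝ} (hαd : α < d) :
    ∫⁻ t in Ici 1, ENNReal.ofReal ((4 * π * t) ^ (-((d : ℝ) / 2))) ∂(powerMeasure α) < ∞ := by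
  rw [powerMeasure, restrict_withDensity measurableSet_Ici, Measure.restrict_restrict
    measurableSet_Ici, inter_eq_self_of_subset_left (Ici_subset_Ioi.2 one_pos),
    lintegral_withDensity_eq_lintegral_mul _ (measurable_powerMeasure_density α) (by fun_prop)]
  have h : IntegrableOn (fun t : ℝ => t ^ (α / 2 - 1 - (d : ℝ) / 2)) (Ici 1) := by
    rw [integrableOn_Ici_iff_integrableOn_Ioi]
    exact integrableOn_Ioi_rpow_of_lt (by linarith) one_pos
  have h2 := (h.mul_const ((4 * π) ^ (-((d : ℝ) / 2)) / Real.Gamma (α / 2))).lintegral_lt_top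
  refine lt_of_le_of_lt (le_of_eq ?_) h2
  refine setLIntegral_congr_fun measurableSet_Ici fun t ht => ?_
  have ht' : (0 : ℝ) < t := lt_of_lt_of_le one_pos ht
  simp only [Pi.mul_apply]
  rw [← ENNReal.ofReal_mul' (by positivity)]
  congr 1
  rw [Real.mul_rpow (by positivity) ht'.le, sub_eq_add_neg (α / 2 - 1), Real.rpow_add ht']
  ring

/-- The Riesz kernel, a multiple of `|x|^{α-d}`, as a superposition of heat kernels. -/
noncomputable def rieszKernel (α : ℝ) (x : EuclideanSpace ℝ (Fin d)) : ℝ≥0∞ :=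
  ∫⁻ t, ENNReal.ofReal (heatKernel t x) ∂(powerMeasure α)

theorem measurable_rieszKernel (α : ℝ) :
    Measurable (rieszKernel α : EuclideanSpace ℝ (Fin d) → ℝ≥0∞) :=
  (measurable_heatKernel.ennreal_ofReal.comp measurable_swap).lintegral_prod_right'

theorem rieszKernel_neg (α : ℝ) (x : EuclideanSpace ℝ (Fin d)) :
    rieszKernel α (-x) = rieszKernel α x := by
  simp only [rieszKernel, heatKernel_neg]

/-- The Riesz kernel is the sum of an integrable and a bounded function. -/
theorem exists_lintegral_rieszKernel_mul_le {α : ℝ} (hα : 0 < α) (hαd : α < d) :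
    ∃ A C : ℝ≥0, ∀ (S : ℝ≥0∞) (f : EuclideanSpace ℝ (Fin d) → ℝ≥0∞), Measurable f →
      (∀ x, f x ≤ S) → ∫⁻ x, rieszKernel α x * f x ≤ A * S + C * ∫⁻ x, f x := by
  -- Times `t < 1` are controlled by the unit mass of the heat kernel and `sup f`, times `t ≥ 1` by
  -- the supremum of the heat kernel and `∫ f`.
  refine ⟨(powerMeasure α (Iio 1)).toNNReal,
    (∫⁻ t in Ici 1, ENNReal.ofReal ((4 * π * t) ^ (-((d : ℝ) / 2)))
      ∂(powerMeasure α)).toNNReal, fun S f hf hS => ?_⟩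
  rw [ENNReal.coe_toNNReal (powerMeasure_Iio_one_lt_top hα).ne,
    ENNReal.coe_toNNReal (lintegral_Ici_one_powerMeasure_lt_top hαd).ne]
  have hm : Measurable (Function.uncurry fun (x : EuclideanSpace ℝ (Fin d)) (t : ℝ) =>
      ENNReal.ofReal (heatKernel t x) * f x) :=
    (measurable_heatKernel.ennreal_ofReal.comp measurable_swap).mul (hf.comp measurable_fst)
  have hmt : ∀ t : ℝ, Measurable fun x : EuclideanSpace ℝ (Fin d) =>
      ENNReal.ofReal (heatKernel t x) := fun t =>
    measurable_heatKernel.ennreal_ofReal.comp measurable_prodMk_left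
  have hmx : ∀ x : EuclideanSpace ℝ (Fin d), Measurable fun t =>
      ENNReal.ofReal (heatKernel t x) := fun x =>
    measurable_heatKernel.ennreal_ofReal.comp measurable_prodMk_right
  calc ∫⁻ x, rieszKernel α x * f x
      = ∫⁻ t, ∫⁻ x, ENNReal.ofReal (heatKernel t x) * f x ∂volume ∂(powerMeasure α) := by
        rw [← lintegral_lintegral_swap hm.aemeasurable]
        refine lintegral_congr fun x => ?_
        rw [lintegral_mul_const _ (hmx x), rieszKernel]
    _ ≤ ∫⁻ t, ((Iio 1).indicator (fun _ => S) t + (Ici 1).indicator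
          (fun t => ENNReal.ofReal ((4 * π * t) ^ (-((d : ℝ) / 2))) * ∫⁻ x, f x) t)
          ∂(powerMeasure α) := by
        refine lintegral_mono_ae ?_
        filter_upwards [ae_powerMeasure_pos α] with t ht
        rcases lt_or_ge t 1 with h1 | h1
        · rw [indicator_of_mem (show t ∈ Iio 1 from h1)]
          refine le_add_right ?_
          calc ∫⁻ x, ENNReal.ofReal (heatKernel t x) * f x
              ≤ ∫⁻ x : EuclideanSpace ℝ (Fin d), ENNReal.ofReal (heatKernel t x) * S := by
                gcongr with x
                exact hS x
            _ = S := by rw [lintegral_mul_const _ (hmt t), lintegral_heatKernel ht, one_mul]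
        · rw [indicator_of_mem (show t ∈ Ici 1 from h1), ← lintegral_const_mul _ hf]
          refine le_add_left ?_
          gcongr with x
          exact heatKernel_le ht.le x
    _ = _ := by
        rw [lintegral_add_left (measurable_const.indicator measurableSet_Iio),
          lintegral_indicator measurableSet_Iio, lintegral_indicator measurableSet_Ici,
          lintegral_const, Measure.restrict_apply_univ, lintegral_mul_const _ (by fun_prop),
          mul_comm S]

theorem exists_setLIntegral_rieszKernel_sub_le {α : ℝ} (hα : 0 < α) (hαd : α < d)
    {Ω : Set (EuclideanSpace ℝ (Fin d))} (hΩ : MeasurableSet Ω) (hΩfin : volume Ω < ∞) :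
    ∃ M : ℝ≥0, ∀ x, ∫⁻ y in Ω, rieszKernel α (x - y) ≤ M := by
  obtain ⟨A, C, h⟩ := exists_lintegral_rieszKernel_mul_le hα hαd
  refine ⟨A + C * (volume Ω).toNNReal, fun x => ?_⟩
  -- Testing on the indicator of `x - Ω`, with supremum at most 1 and integral `|Ω|`, gives a bound
  -- uniform in `x`.
  have h1 := h 1 (fun z => Ω.indicator 1 (x - z))
    ((measurable_one.indicator hΩ).comp (measurable_const.sub measurable_id)) fun z => by
      exact indicator_le_self' (fun _ _ => zero_le) (x - z)
  rw [lintegral_sub_left_eq_self (fun z => Ω.indicator (1 : EuclideanSpace ℝ (Fin d) → ℝ≥0∞) z) x,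
    lintegral_indicator_one hΩ, mul_one] at h1
  rw [ENNReal.coe_add, ENNReal.coe_mul, ENNReal.coe_toNNReal hΩfin.ne]
  refine le_trans (le_of_eq ?_) h1
  rw [← lintegral_indicator hΩ, ← lintegral_sub_left_eq_self _ x]
  refine lintegral_congr fun z => ?_
  by_cases hz : x - z ∈ Ω <;> simp [hz]

end RieszPotential

/-! ### The Fourier transform of the Riesz kernel and uniqueness. -/

section FourierTransform

open Set
open scoped NNReal ComplexConjugate Real FourierTransform

variable {d : ℕ}

theorem fourierHat_eq_fourier (φ : 𝓢(EuclideanSpace ℝ (Fin d), ℂ))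
    (x : EuclideanSpace ℝ (Fin d)) : fourierHat φ x = 𝓕 φ ((2 * π)⁻¹ • x) := by
  rw [fourierHat, SchwartzMap.fourier_coe, Real.fourier_eq']
  refine integral_congr_ae (Filter.Eventually.of_forall fun y => ?_)
  simp only [smul_eq_mul]
  congr 2
  rw [inner_smul_right]
  push_cast
  field_simp

theorem exists_eq_comp_smul (ψ : 𝓢(EuclideanSpace ℝ (Fin d), ℂ)) {c : ℝ} (hc : c ≠ 0) :
    ∃ φ : 𝓢(EuclideanSpace ℝ (Fin d), ℂ), ∀ x, φ x = ψ (c • x) :=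
  ⟨SchwartzMap.compCLMOfContinuousLinearEquiv ℂ
    (ContinuousLinearEquiv.smulLeft (R₁ := ℝ) (Units.mk0 c hc)) ψ, fun _ => rfl⟩

theorem exists_schwartzMap_eq_fourierHat (φ : 𝓢(EuclideanSpace ℝ (Fin d), ℂ)) :
    ∃ ψ : 𝓢(EuclideanSpace ℝ (Fin d), ℂ), ∀ x, fourierHat φ x = ψ x := by
  obtain ⟨ψ, hψ⟩ := exists_eq_comp_smul (𝓕 φ) (c := (2 * π)⁻¹) (by positivity)
  exact ⟨ψ, fun x => by rw [fourierHat_eq_fourier, hψ]⟩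

/-- Surjectivity of the transform on Schwartz functions: pairings with all `φ̂` are pairings with
all test functions, so `K` is determined by `K̂`. -/
theorem exists_fourierHat_eq (ψ : 𝓢(EuclideanSpace ℝ (Fin d), ℂ)) :
    ∃ φ : 𝓢(EuclideanSpace ℝ (Fin d), ℂ), ∀ x, fourierHat φ x = ψ x := by
  obtain ⟨χ, hχ⟩ := exists_eq_comp_smul ψ (c := 2 * π) (by positivity)
  refine ⟨𝓕⁻ χ, fun x => ?_⟩
  rw [fourierHat_eq_fourier, FourierTransform.fourier_fourierInv_eq, hχ, smul_smul,
    mul_inv_cancel₀ (by positivity), one_smul]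

theorem locallyIntegrable_of_integrable_mul_schwartz {f : EuclideanSpace ℝ (Fin d) → ℂ}
    (hf : ∀ φ : 𝓢(EuclideanSpace ℝ (Fin d), ℂ), Integrable fun x => f x * φ x) :
    LocallyIntegrable f := by
  intro x
  -- This bump equals 1 on the closed unit ball around `x`, so there `f` coincides with the
  -- integrable product `f b`.
  let b : ContDiffBump x := ⟨1, 2, one_pos, one_lt_two⟩
  have hb : HasCompactSupport (Complex.ofRealCLM ∘ b) := b.hasCompactSupport.comp_left rfl
  have hb' := Complex.ofRealCLM.contDiff.comp (b.contDiff (n := ⊤))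
  refine ⟨Metric.closedBall x 1, Metric.closedBall_mem_nhds x one_pos, ?_⟩
  refine ((hf (hb.toSchwartzMap hb')).integrableOn
    (s := Metric.closedBall x 1)).congr_fun
    (fun y hy => ?_) measurableSet_closedBall
  have h1 : b y = 1 := b.one_of_mem_closedBall hy
  simp [h1]

/-- Two functions that define the same tempered distribution agree almost everywhere. -/
theorem ae_eq_of_integral_mul_schwartz_eq {f g : EuclideanSpace ℝ (Fin d) → ℂ}
    (hf : ∀ φ : 𝓢(EuclideanSpace ℝ (Fin d), ℂ), Integrable fun x => f x * φ x)
    (hg : ∀ φ : 𝓢(EuclideanSpace ℝ (Fin d), ℂ), Integrable fun x => g x * φ x)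
    (h : ∀ φ : 𝓢(EuclideanSpace ℝ (Fin d), ℂ), ∫ x, f x * φ x = ∫ x, g x * φ x) :
    f =ᵐ[volume] g := by
  refine ae_eq_of_integral_contDiff_smul_eq (locallyIntegrable_of_integrable_mul_schwartz hf)
    (locallyIntegrable_of_integrable_mul_schwartz hg) fun φ hφ hφc => ?_
  have hφc' : HasCompactSupport (Complex.ofRealCLM ∘ φ) := hφc.comp_left rfl
  have hφ' := Complex.ofRealCLM.contDiff.comp hφ
  have := h (hφc'.toSchwartzMap hφ')
  simpa [mul_comm] using this

theorem integrable_heatKernel_mul {α : ℝ} (hα : 0 < α) (hαd : α < d)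
    (ψ : 𝓢(EuclideanSpace ℝ (Fin d), ℂ)) :
    Integrable (fun p : EuclideanSpace ℝ (Fin d) × ℝ => (heatKernel p.2 p.1 : ℂ) * ψ p.1)
      (volume.prod (powerMeasure α)) := by
  have hm : Measurable fun p : EuclideanSpace ℝ (Fin d) × ℝ =>
      (heatKernel p.2 p.1 : ℂ) * ψ p.1 :=
    (Complex.measurable_ofReal.comp (measurable_heatKernel.comp measurable_swap)).mul
      (ψ.continuous.measurable.comp measurable_fst)
  refine ⟨hm.aestronglyMeasurable, ?_⟩
  obtain ⟨A, C, h⟩ := exists_lintegral_rieszKernel_mul_le hα hαd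
  have h1 := h (ENNReal.ofReal (SchwartzMap.seminorm ℝ 0 0 ψ)) (fun x => ‖ψ x‖ₑ)
    ψ.continuous.measurable.enorm fun x => by
      rw [← ofReal_norm]
      exact ENNReal.ofReal_le_ofReal (SchwartzMap.norm_le_seminorm ℝ ψ x)
  have h2 : ∫⁻ x, ‖ψ x‖ₑ < ∞ := ψ.integrable.2
  rw [HasFiniteIntegral, lintegral_prod _ hm.enorm.aemeasurable]
  refine lt_of_le_of_lt (le_of_eq ?_) (h1.trans_lt (ENNReal.add_lt_top.2
    ⟨ENNReal.mul_lt_top ENNReal.coe_lt_top ENNReal.ofReal_lt_top,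
      ENNReal.mul_lt_top ENNReal.coe_lt_top h2⟩))
  refine lintegral_congr fun x => ?_
  rw [rieszKernel, ← lintegral_mul_const _
    (by exact measurable_heatKernel.ennreal_ofReal.comp measurable_prodMk_right)]
  refine lintegral_congr_ae ?_
  filter_upwards [ae_powerMeasure_pos α] with t ht
  rw [enorm_mul, enorm_ofReal, Real.enorm_of_nonneg (heatKernel_nonneg ht.le x)]

theorem ofReal_toReal_rieszKernel (α : ℝ) (x : EuclideanSpace ℝ (Fin d)) :
    ((rieszKernel α x).toReal : ℂ) = ∫ t, (heatKernel t x : ℂ) ∂(powerMeasure α) := by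
  -- No finiteness is needed: if the integral diverges, as at the origin for `0 < α < d`, both sides
  -- take the default value 0.
  rw [integral_complex_ofReal, rieszKernel, integral_eq_lintegral_of_nonneg_ae]
  · filter_upwards [ae_powerMeasure_pos α] with t ht using heatKernel_nonneg ht.le x
  · exact (measurable_heatKernel.comp measurable_prodMk_right).aestronglyMeasurable

theorem ofReal_toReal_rieszKernel_mul (α : ℝ) (ψ : 𝓢(EuclideanSpace ℝ (Fin d), ℂ)) :
    (fun x => ((rieszKernel α x).toReal : ℂ) * ψ x) =
      fun x => ∫ t, (heatKernel t x : ℂ) * ψ x ∂(powerMeasure α) := by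
  ext x
  rw [ofReal_toReal_rieszKernel, integral_mul_const]

theorem integrable_rieszKernel_mul {α : ℝ} (hα : 0 < α) (hαd : α < d)
    (ψ : 𝓢(EuclideanSpace ℝ (Fin d), ℂ)) :
    Integrable fun x => ((rieszKernel α x).toReal : ℂ) * ψ x := by
  rw [ofReal_toReal_rieszKernel_mul]
  exact (integrable_heatKernel_mul hα hαd ψ).integral_prod_left

/-- The multiplication formula `∫ f φ̂ = ∫ f̂ φ` for a Gaussian, by Fubini. -/
theorem integral_heatKernel_mul_fourierHat {t : ℝ} (ht : 0 < t)
    (φ : 𝓢(EuclideanSpace ℝ (Fin d), ℂ)) :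
    ∫ x, (heatKernel t x : ℂ) * fourierHat φ x =
      ∫ ξ, ((Real.exp (-t * ‖ξ‖ ^ 2) : ℝ) : ℂ) * φ ξ := by
  have hint : Integrable (Function.uncurry fun x ξ : EuclideanSpace ℝ (Fin d) =>
      (heatKernel t x : ℂ) *
        (Complex.exp (-(Complex.I * ((inner ℝ ξ x : ℝ) : ℂ))) * φ ξ)) (volume.prod volume) := by
    have h1 := (integrable_heatKernel (d := d) ht).ofReal (𝕜 := ℂ)
    have h2 := (h1.mul_prod (φ.integrable (μ := volume))).bdd_mul (c := 1)
      (f := fun p : EuclideanSpace ℝ (Fin d) × EuclideanSpace ℝ (Fin d) =>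
        Complex.exp (-(Complex.I * ((inner ℝ p.2 p.1 : ℝ) : ℂ))))
      (by
        refine Continuous.aestronglyMeasurable ?_
        fun_prop)
      (Filter.Eventually.of_forall fun p => by
        rw [Complex.norm_exp]
        simp)
    refine h2.congr (Filter.Eventually.of_forall fun p => ?_)
    simp only [Function.uncurry]
    exact mul_left_comm _ _ _
  simp only [fourierHat, ← integral_const_mul]
  rw [integral_integral_swap hint]
  refine integral_congr_ae (Filter.Eventually.of_forall fun ξ => ?_)
  simp only
  rw [← integral_exp_mul_heatKernel ht, ← integral_mul_const]
  refine integral_congr_ae (Filter.Eventually.of_forall fun x => ?_)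
  simp only
  rw [real_inner_comm]
  ring

theorem lintegral_exp_neg_sq_powerMeasure {α : ℝ} (hα : 0 < α) {ξ : EuclideanSpace ℝ (Fin d)}
    (hξ : ξ ≠ 0) :
    ∫⁻ t, ENNReal.ofReal (Real.exp (-t * ‖ξ‖ ^ 2)) ∂(powerMeasure α) =
      ENNReal.ofReal (‖ξ‖ ^ (-α)) := by
  have h0 : 0 < ‖ξ‖ := norm_pos_iff.2 hξ
  rw [lintegral_exp_neg_powerMeasure hα (by positivity), ← Real.rpow_two,
    ← Real.rpow_mul h0.le]
  congr 2
  ring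

/-- The Fourier transform of the Riesz kernel is `|ξ|^{-α}`. -/
theorem integral_rieszKernel_mul_fourierHat {α : ℝ} (hα : 0 < α) (hαd : α < d)
    (φ : 𝓢(EuclideanSpace ℝ (Fin d), ℂ))
    (hφ : Integrable fun ξ : EuclideanSpace ℝ (Fin d) => ((‖ξ‖ ^ (-α) : ℝ) : ℂ) * φ ξ) :
    ∫ x, ((rieszKernel α x).toReal : ℂ) * fourierHat φ x =
      ∫ ξ : EuclideanSpace ℝ (Fin d), ((‖ξ‖ ^ (-α) : ℝ) : ℂ) * φ ξ := by
  have hd : 0 < d := by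
    have : (0 : ℝ) < d := hα.trans hαd
    exact_mod_cast this
  have : Nonempty (Fin d) := ⟨⟨0, hd⟩⟩
  -- The origin has to be discarded: there the Laplace integral is infinite, whereas `0 ^ (-α) = 0`
  -- in Lean. It is null because `0 < α < d` forces `d ≥ 1`.
  have hne : ∀ᵐ ξ : EuclideanSpace ℝ (Fin d), ξ ≠ 0 := Measure.ae_ne volume 0
  obtain ⟨ψ, hψ⟩ := exists_schwartzMap_eq_fourierHat φ
  have hm : Measurable (Function.uncurry fun (ξ : EuclideanSpace ℝ (Fin d)) (t : ℝ) =>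
      ((Real.exp (-t * ‖ξ‖ ^ 2) : ℝ) : ℂ) * φ ξ) := by
    refine Measurable.mul ?_ (φ.continuous.measurable.comp measurable_fst)
    fun_prop
  have hint : Integrable (Function.uncurry fun (ξ : EuclideanSpace ℝ (Fin d)) (t : ℝ) =>
      ((Real.exp (-t * ‖ξ‖ ^ 2) : ℝ) : ℂ) * φ ξ) (volume.prod (powerMeasure α)) := by
    refine ⟨hm.aestronglyMeasurable, ?_⟩
    rw [HasFiniteIntegral, lintegral_prod _ hm.enorm.aemeasurable]
    refine lt_of_le_of_lt (le_of_eq ?_) hφ.2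
    refine lintegral_congr_ae ?_
    filter_upwards [hne] with ξ hξ
    simp only [Function.uncurry, enorm_mul, enorm_ofReal]
    rw [lintegral_mul_const _ (by fun_prop), Real.enorm_of_nonneg (by positivity),
      ← lintegral_exp_neg_sq_powerMeasure hα hξ]
    congr 1
    refine lintegral_congr fun t => ?_
    rw [Real.enorm_of_nonneg (Real.exp_pos _).le]
  calc ∫ x, ((rieszKernel α x).toReal : ℂ) * fourierHat φ x
      = ∫ x, ∫ t, (heatKernel t x : ℂ) * ψ x ∂(powerMeasure α) := by
        simp only [hψ]
        rw [ofReal_toReal_rieszKernel_mul]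
    _ = ∫ t, ∫ x, (heatKernel t x : ℂ) * fourierHat φ x ∂volume ∂(powerMeasure α) := by
        rw [integral_integral_swap (integrable_heatKernel_mul hα hαd ψ)]
        simp only [hψ]
    _ = ∫ t, ∫ ξ, ((Real.exp (-t * ‖ξ‖ ^ 2) : ℝ) : ℂ) * φ ξ ∂volume ∂(powerMeasure α) := by
        refine integral_congr_ae ?_
        filter_upwards [ae_powerMeasure_pos α] with t ht
        exact integral_heatKernel_mul_fourierHat ht φ
    _ = ∫ ξ, ∫ t, ((Real.exp (-t * ‖ξ‖ ^ 2) : ℝ) : ℂ) * φ ξ ∂(powerMeasure α) :=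
        (integral_integral_swap hint).symm
    _ = _ := by
        refine integral_congr_ae ?_
        filter_upwards [hne] with ξ hξ
        rw [integral_mul_const, integral_complex_ofReal, integral_eq_lintegral_of_nonneg_ae
          (Filter.Eventually.of_forall fun t => (Real.exp_pos _).le)
          (by fun_prop), lintegral_exp_neg_sq_powerMeasure hα hξ,
          ENNReal.toReal_ofReal (by positivity)]

/-- A function with Fourier transform `|ξ|^{-α}` is the Riesz kernel. -/
theorem HasDistribFourier.ae_eq_rieszKernel {α : ℝ} (hα : 0 < α) (hαd : α < d)
    {K : EuclideanSpace ℝ (Fin d) → ℂ}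
    (hK : HasDistribFourier K (fun ξ => ((‖ξ‖ ^ (-α) : ℝ) : ℂ))) :
    ∀ᵐ x, K x = ((rieszKernel α x).toReal : ℂ) := by
  refine ae_eq_of_integral_mul_schwartz_eq hK.integrable_left
    (integrable_rieszKernel_mul hα hαd) fun ψ => ?_
  obtain ⟨φ, hφ⟩ := exists_fourierHat_eq ψ
  simp only [← hφ]
  rw [hK.pairing, integral_rieszKernel_mul_fourierHat hα hαd φ (hK.integrable_right φ)]

end FourierTransform

/-! ### Quadratic forms in Fourier space, with the Bessel and Plancherel inequalities. -/

section QuadraticForm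

open Set
open scoped NNReal ComplexConjugate Real

variable {d : ℕ} {Ω : Set (EuclideanSpace ℝ (Fin d))}

/-- The Fourier transform of the extension by zero of a function on `Ω`. -/
noncomputable def fourierOn (Ω : Set (EuclideanSpace ℝ (Fin d)))
    (u : EuclideanSpace ℝ (Fin d) → ℂ) (ξ : EuclideanSpace ℝ (Fin d)) : ℂ :=
  ∫ y in Ω, Complex.exp (-(Complex.I * ((inner ℝ y ξ : ℝ) : ℂ))) * u y

theorem norm_exp_neg_I_mul (r : ℝ) : ‖Complex.exp (-(Complex.I * (r : ℂ)))‖ = 1 := by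
  rw [Complex.norm_exp]
  simp

theorem measurable_fourierOn (u : L2 Ω) : Measurable (fourierOn Ω u) := by
  have hu : Measurable u := (Lp.stronglyMeasurable u).measurable
  have hm : StronglyMeasurable fun p : EuclideanSpace ℝ (Fin d) × EuclideanSpace ℝ (Fin d) =>
      Complex.exp (-(Complex.I * ((inner ℝ p.2 p.1 : ℝ) : ℂ))) * u p.2 := by
    refine (Measurable.mul (Continuous.measurable ?_) (hu.comp measurable_snd)).stronglyMeasurable
    fun_prop
  exact hm.integral_prod_right'.measurable

variable [IsFiniteMeasure (volume.restrict Ω)]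

theorem integrable_L2 (u : L2 Ω) : Integrable u (volume.restrict Ω) :=
  (Lp.memLp u).integrable one_le_two

omit [IsFiniteMeasure (volume.restrict Ω)] in
theorem norm_fourierOn_le (u : L2 Ω) (ξ : EuclideanSpace ℝ (Fin d)) :
    ‖fourierOn Ω u ξ‖ ≤ ∫ y in Ω, ‖u y‖ := by
  refine (norm_integral_le_integral_norm _).trans (le_of_eq ?_)
  simp only [norm_mul, norm_exp_neg_I_mul, one_mul]

/-- Bessel's inequality for the characters restricted to `Ω`. -/
theorem sum_norm_fourierOn_sq_le {n : ℕ} {v : Fin n → L2 Ω} (hv : Orthonormal ℂ v)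
    (ξ : EuclideanSpace ℝ (Fin d)) : ∑ i, ‖fourierOn Ω (v i) ξ‖ ^ 2 ≤ volume.real Ω := by
  -- The inner product is conjugate-linear on the left, so `⟨e, vᵢ⟩ = v̂ᵢ(ξ)`. As `|e| = 1`, the
  -- squared norm of `e` in `L²(Ω)` is `|Ω|`.
  let e : EuclideanSpace ℝ (Fin d) → ℂ := fun y => conj (Complex.exp
    (-(Complex.I * ((inner ℝ y ξ : ℝ) : ℂ))))
  have hn : ∀ y, ‖e y‖ = 1 := fun y => by rw [RCLike.norm_conj, norm_exp_neg_I_mul]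
  have hec : Continuous e := Complex.continuous_conj.comp (by fun_prop)
  have he : MemLp e 2 (volume.restrict Ω) :=
    MemLp.of_bound hec.aestronglyMeasurable 1 (Filter.Eventually.of_forall fun y => (hn y).le)
  have hin : ∀ i, inner ℂ (he.toLp e) (v i) = fourierOn Ω (v i) ξ := fun i => by
    rw [L2.inner_def, fourierOn]
    refine integral_congr_ae ?_
    filter_upwards [he.coeFn_toLp] with y hy
    rw [hy, RCLike.inner_apply, mul_comm]
    simp [e]
  have hnorm : ‖he.toLp e‖ ^ 2 = volume.real Ω := by
    rw [← Complex.ofReal_inj, Complex.ofReal_pow]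
    have h1 := inner_self_eq_norm_sq_to_K (𝕜 := ℂ) (he.toLp e)
    rw [L2.inner_def] at h1
    refine Eq.trans h1.symm ?_
    have h2 : ∫ y in Ω, inner ℂ (he.toLp e y) (he.toLp e y) = ∫ y in Ω, (1 : ℂ) := by
      refine integral_congr_ae ?_
      filter_upwards [he.coeFn_toLp] with y hy
      rw [hy, inner_self_eq_norm_sq_to_K, hn]
      simp
    rw [h2]
    simp
  rw [← hnorm]
  refine le_trans (le_of_eq ?_) (hv.sum_inner_products_le (he.toLp e) (s := Finset.univ))
  refine Finset.sum_congr rfl fun i _ => ?_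
  rw [← hin, norm_inner_symm]

/-- The quadratic form of the heat kernel in Fourier space. -/
theorem integral_heatKernel_form {t : ℝ} (ht : 0 < t) (u : L2 Ω) :
    ∫ p, (heatKernel t (p.1 - p.2) : ℂ) * conj (u p.2) * u p.1
      ∂((volume.restrict Ω).prod (volume.restrict Ω)) =
    ((((2 * π) ^ (d : ℝ))⁻¹ *
      ∫ ξ, Real.exp (-t * ‖ξ‖ ^ 2) * ‖fourierOn Ω u ξ‖ ^ 2 : ℝ) : ℂ) := by
  set μ : Measure (EuclideanSpace ℝ (Fin d)) := volume.restrict Ω with hμ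
  have hu := integrable_L2 u
  have huc : Integrable (fun y => conj (u y)) μ := Complex.conjCLE.integrable_comp_iff.2 hu
  have hint : Integrable (Function.uncurry
      fun (p : EuclideanSpace ℝ (Fin d) × EuclideanSpace ℝ (Fin d))
        (ξ : EuclideanSpace ℝ (Fin d)) =>
      Complex.exp (-(Complex.I * ((inner ℝ ξ (p.1 - p.2) : ℝ) : ℂ))) *
      ((Real.exp (-t * ‖ξ‖ ^ 2) : ℝ) : ℂ) * (conj (u p.2) * u p.1)) ((μ.prod μ).prod volume) := by
    have h1 : Integrable fun ξ : EuclideanSpace ℝ (Fin d) =>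
        ((Real.exp (-t * ‖ξ‖ ^ 2) : ℝ) : ℂ) := (integrable_gaussian ht).ofReal
    have h2 := ((hu.mul_prod huc).mul_prod h1).bdd_mul (c := 1)
      (f := fun q : (EuclideanSpace ℝ (Fin d) × EuclideanSpace ℝ (Fin d)) ×
          EuclideanSpace ℝ (Fin d) =>
        Complex.exp (-(Complex.I * ((inner ℝ q.2 (q.1.1 - q.1.2) : ℝ) : ℂ))))
      (by
        refine Continuous.aestronglyMeasurable ?_
        fun_prop)
      (Filter.Eventually.of_forall fun q => (norm_exp_neg_I_mul _).le)
    refine h2.congr (Filter.Eventually.of_forall fun q => ?_)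
    simp only [Function.uncurry]
    ring
  -- For fixed `ξ` the character of `x - y` factors, so the double integral is `û(ξ)` times its
  -- conjugate.
  have hinner : ∀ ξ : EuclideanSpace ℝ (Fin d),
      ∫ p : EuclideanSpace ℝ (Fin d) × EuclideanSpace ℝ (Fin d),
        Complex.exp (-(Complex.I * ((inner ℝ ξ (p.1 - p.2) : ℝ) : ℂ))) *
        ((Real.exp (-t * ‖ξ‖ ^ 2) : ℝ) : ℂ) * (conj (u p.2) * u p.1) ∂(μ.prod μ) =
      ((Real.exp (-t * ‖ξ‖ ^ 2) * ‖fourierOn Ω u ξ‖ ^ 2 : ℝ) : ℂ) := by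
    intro ξ
    have h1 : ∀ p : EuclideanSpace ℝ (Fin d) × EuclideanSpace ℝ (Fin d),
        Complex.exp (-(Complex.I * ((inner ℝ ξ (p.1 - p.2) : ℝ) : ℂ))) *
        ((Real.exp (-t * ‖ξ‖ ^ 2) : ℝ) : ℂ) * (conj (u p.2) * u p.1) =
        ((Real.exp (-t * ‖ξ‖ ^ 2) : ℝ) : ℂ) *
        ((Complex.exp (-(Complex.I * ((inner ℝ p.1 ξ : ℝ) : ℂ))) * u p.1) *
          conj (Complex.exp (-(Complex.I * ((inner ℝ p.2 ξ : ℝ) : ℂ))) * u p.2)) := by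
      intro p
      have h2 : Complex.exp (-(Complex.I * ((inner ℝ ξ (p.1 - p.2) : ℝ) : ℂ))) =
          Complex.exp (-(Complex.I * ((inner ℝ p.1 ξ : ℝ) : ℂ))) *
          conj (Complex.exp (-(Complex.I * ((inner ℝ p.2 ξ : ℝ) : ℂ)))) := by
        rw [← Complex.exp_conj, ← Complex.exp_add, inner_sub_right, real_inner_comm,
          real_inner_comm ξ p.2]
        congr 1
        simp only [map_neg, map_mul, Complex.conj_I, Complex.conj_ofReal]
        push_cast
        ring
      rw [h2, map_mul]
      ring
    simp only [h1]
    rw [integral_const_mul, integral_prod_mul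
      (fun x => Complex.exp (-(Complex.I * ((inner ℝ x ξ : ℝ) : ℂ))) * u x)
      (fun y => conj (Complex.exp (-(Complex.I * ((inner ℝ y ξ : ℝ) : ℂ))) * u y)),
      integral_conj, Complex.ofReal_mul, Complex.ofReal_pow]
    congr 1
    exact Complex.mul_conj' _
  have hpt : ∀ p : EuclideanSpace ℝ (Fin d) × EuclideanSpace ℝ (Fin d),
      (heatKernel t (p.1 - p.2) : ℂ) * conj (u p.2) * u p.1 =
      (((2 * π) ^ (d : ℝ))⁻¹ : ℝ) * ∫ ξ : EuclideanSpace ℝ (Fin d),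
        Complex.exp (-(Complex.I * ((inner ℝ ξ (p.1 - p.2) : ℝ) : ℂ))) *
        ((Real.exp (-t * ‖ξ‖ ^ 2) : ℝ) : ℂ) * (conj (u p.2) * u p.1) := by
    intro p
    have hpos : (((2 * π) ^ (d : ℝ) : ℝ) : ℂ) ≠ 0 := by
      have : (0 : ℝ) < (2 * π) ^ (d : ℝ) := by positivity
      exact_mod_cast this.ne'
    rw [integral_mul_const, integral_exp_mul_exp_neg ht, Complex.ofReal_mul, Complex.ofReal_inv,
      mul_assoc, mul_assoc, inv_mul_cancel_left₀ hpos]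
  simp only [hpt]
  rw [integral_const_mul, integral_integral_swap hint, Complex.ofReal_mul]
  simp only [hinner, integral_complex_ofReal]

omit [IsFiniteMeasure (volume.restrict Ω)] in
theorem integrable_exp_mul_fourierOn_sq {t : ℝ} (ht : 0 < t) (u : L2 Ω) :
    Integrable fun ξ => Real.exp (-t * ‖ξ‖ ^ 2) * ‖fourierOn Ω u ξ‖ ^ 2 := by
  refine (integrable_gaussian ht).mul_bdd (c := (∫ y in Ω, ‖u y‖) ^ 2)
    ((measurable_fourierOn u).norm.pow_const 2).aestronglyMeasurable
    (Filter.Eventually.of_forall fun ξ => ?_)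
  rw [norm_pow, norm_norm]
  have := norm_fourierOn_le u ξ
  gcongr

omit [IsFiniteMeasure (volume.restrict Ω)] in
theorem setLIntegral_enorm_heatKernel_sub_le {t : ℝ} (ht : 0 < t) (x : EuclideanSpace ℝ (Fin d)) :
    ∫⁻ y in Ω, ‖heatKernel t (x - y)‖ₑ ≤ (1 : ℝ≥0) := by
  refine (setLIntegral_le_lintegral _ _).trans ?_
  rw [lintegral_sub_left_eq_self (fun z => ‖heatKernel t z‖ₑ) x, ENNReal.coe_one,
    ← lintegral_heatKernel ht (d := d)]
  refine lintegral_mono fun z => ?_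
  rw [Real.enorm_of_nonneg (heatKernel_nonneg ht.le z)]

/-- The heat kernel has mass one, so Schur's test makes its operator on `L²(Ω)` a contraction. Up to
`(2π)^d`, the left side is the quadratic form of that operator. -/
theorem integral_exp_mul_fourierOn_sq_le {t : ℝ} (ht : 0 < t) (u : L2 Ω) :
    ∫ ξ, Real.exp (-t * ‖ξ‖ ^ 2) * ‖fourierOn Ω u ξ‖ ^ 2 ≤ (2 * π) ^ (d : ℝ) * ‖u‖ ^ 2 := by
  have hm : Measurable (Function.uncurry fun x y : EuclideanSpace ℝ (Fin d) =>
      heatKernel t (x - y)) :=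
    measurable_heatKernel.comp (measurable_const.prodMk (measurable_fst.sub measurable_snd))
  obtain ⟨T, hTn, hT⟩ := exists_kernelOperator (μ := volume.restrict Ω) hm (heatKernel_sub_comm t)
    (setLIntegral_enorm_heatKernel_sub_le ht)
  have h1 := inner_kernelOperator hm (heatKernel_sub_comm t)
    (setLIntegral_enorm_heatKernel_sub_le ht) ((hT u).mono fun _ h => h.2)
  rw [integral_heatKernel_form ht] at h1
  have h2 : ‖inner ℂ (T u) u‖ ≤ ‖u‖ ^ 2 := by
    refine (norm_inner_le_norm _ _).trans ?_
    rw [pow_two]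
    gcongr
    exact (T.le_opNorm u).trans (mul_le_of_le_one_left (norm_nonneg u) (by simpa using hTn))
  rw [h1, Complex.norm_real] at h2
  have h3 := (le_abs_self _).trans h2
  rwa [inv_mul_le_iff₀ (by positivity)] at h3

/-- The easy half of Plancherel's theorem. -/
theorem lintegral_fourierOn_sq_le (u : L2 Ω) :
    ∫⁻ ξ, ‖fourierOn Ω u ξ‖ₑ ^ 2 ≤ ENNReal.ofReal ((2 * π) ^ (d : ℝ) * ‖u‖ ^ 2) := by
  -- The Gaussian damping is removed along `t = 1/(n+1) → 0` with Fatou's lemma.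
  let F : ℕ → EuclideanSpace ℝ (Fin d) → ℝ≥0∞ := fun n ξ =>
    ENNReal.ofReal (Real.exp (-(1 / ((n : ℝ) + 1)) * ‖ξ‖ ^ 2) * ‖fourierOn Ω u ξ‖ ^ 2)
  have hF : ∀ n, ∫⁻ ξ, F n ξ ≤ ENNReal.ofReal ((2 * π) ^ (d : ℝ) * ‖u‖ ^ 2) := fun n => by
    rw [← ofReal_integral_eq_lintegral_ofReal
      (integrable_exp_mul_fourierOn_sq (t := 1 / ((n : ℝ) + 1)) (by positivity) u)
      (Filter.Eventually.of_forall fun ξ => by positivity)]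
    exact ENNReal.ofReal_le_ofReal (integral_exp_mul_fourierOn_sq_le (by positivity) u)
  have hlim : ∀ ξ, Filter.Tendsto (fun n => F n ξ) Filter.atTop
      (nhds (‖fourierOn Ω u ξ‖ₑ ^ 2)) := fun ξ => by
    have h0 := tendsto_one_div_add_atTop_nhds_zero_nat (𝕜 := ℝ)
    have h1 := (Real.continuous_exp.tendsto _).comp (h0.neg.mul_const (‖ξ‖ ^ 2))
    have h2 := ENNReal.tendsto_ofReal (h1.mul_const (‖fourierOn Ω u ξ‖ ^ 2))
    rw [neg_zero, zero_mul, Real.exp_zero, one_mul, ENNReal.ofReal_pow (norm_nonneg _),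
      ofReal_norm] at h2
    exact h2
  calc ∫⁻ ξ, ‖fourierOn Ω u ξ‖ₑ ^ 2 = ∫⁻ ξ, Filter.liminf (fun n => F n ξ) Filter.atTop :=
        lintegral_congr fun ξ => (hlim ξ).liminf_eq.symm
    _ ≤ Filter.liminf (fun n => ∫⁻ ξ, F n ξ) Filter.atTop := by
        refine lintegral_liminf_le fun n => Measurable.ennreal_ofReal ?_
        exact Measurable.mul (by fun_prop) ((measurable_fourierOn u).norm.pow_const 2)
    _ ≤ _ := by
        refine (Filter.liminf_le_liminf (Filter.Eventually.of_forall hF)).trans ?_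
        rw [Filter.liminf_const]

/-- The quadratic form of the Riesz potential in Fourier space. -/
theorem rieszKernel_form {α : ℝ} (hα : 0 < α) (hαd : α < d) {M : ℝ≥0}
    (hM : ∀ x, ∫⁻ y in Ω, rieszKernel α (x - y) ≤ M) (u : L2 Ω) :
    ∃ q : ℝ, 0 ≤ q ∧
      ∫ p, ((rieszKernel α (p.1 - p.2)).toReal : ℂ) * conj (u p.2) * u p.1
        ∂((volume.restrict Ω).prod (volume.restrict Ω)) = q ∧
      ENNReal.ofReal q = ENNReal.ofReal ((2 * π) ^ (d : ℝ))⁻¹ *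
        ∫⁻ ξ : EuclideanSpace ℝ (Fin d), ENNReal.ofReal (‖ξ‖ ^ (-α)) * ‖fourierOn Ω u ξ‖ₑ ^ 2 := by
  have hd : 0 < d := by
    have : (0 : ℝ) < d := hα.trans hαd
    exact_mod_cast this
  have : Nonempty (Fin d) := ⟨⟨0, hd⟩⟩
  have hne : ∀ᵐ ξ : EuclideanSpace ℝ (Fin d), ξ ≠ 0 := Measure.ae_ne volume 0
  have hu : Measurable u := (Lp.stronglyMeasurable u).measurable
  have hhm : Measurable fun q : (EuclideanSpace ℝ (Fin d) × EuclideanSpace ℝ (Fin d)) × ℝ =>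
      heatKernel q.2 (q.1.1 - q.1.2) :=
    measurable_heatKernel.comp (measurable_snd.prodMk
      ((measurable_fst.comp measurable_fst).sub (measurable_snd.comp measurable_fst)))
  have hrm : Measurable (Function.uncurry fun x y : EuclideanSpace ℝ (Fin d) =>
      rieszKernel α (x - y)) :=
    (measurable_rieszKernel α).comp (measurable_fst.sub measurable_snd)
  have hum : Measurable fun p : EuclideanSpace ℝ (Fin d) × EuclideanSpace ℝ (Fin d) =>
      conj (u p.2) * u p.1 :=
    (Complex.continuous_conj.measurable.comp (hu.comp measurable_snd)).mul
      (hu.comp measurable_fst)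
  have hint : Integrable (Function.uncurry
      fun (p : EuclideanSpace ℝ (Fin d) × EuclideanSpace ℝ (Fin d)) (t : ℝ) =>
        (heatKernel t (p.1 - p.2) : ℂ) * (conj (u p.2) * u p.1))
      (((volume.restrict Ω).prod (volume.restrict Ω)).prod (powerMeasure α)) := by
    have hm : Measurable (Function.uncurry
      fun (p : EuclideanSpace ℝ (Fin d) × EuclideanSpace ℝ (Fin d)) (t : ℝ) =>
        (heatKernel t (p.1 - p.2) : ℂ) * (conj (u p.2) * u p.1)) :=
      (Complex.measurable_ofReal.comp hhm).mul (hum.comp measurable_fst)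
    refine ⟨hm.aestronglyMeasurable, ?_⟩
    rw [HasFiniteIntegral, lintegral_prod _ hm.enorm.aemeasurable]
    have h1 := lintegral_lintegral_mul_mul_le (μ := volume.restrict Ω) hrm
      (fun x y => by rw [← rieszKernel_neg, neg_sub]) hM hu.enorm
    have h2 := h1.trans_lt (ENNReal.mul_lt_top (by finiteness) (lintegral_enorm_sq_Lp_lt_top u))
    rw [lintegral_lintegral ((hrm.mul (hu.enorm.comp measurable_snd)).mul
      (hu.enorm.comp measurable_fst)).aemeasurable] at h2
    refine lt_of_le_of_lt (le_of_eq (lintegral_congr fun p => ?_)) h2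
    simp only [Function.uncurry, enorm_mul, enorm_ofReal]
    rw [lintegral_mul_const _ (by exact (hhm.comp measurable_prodMk_left).enorm), mul_assoc,
      rieszKernel]
    congr 1
    · refine lintegral_congr_ae ?_
      filter_upwards [ae_powerMeasure_pos α] with t ht
      exact Real.enorm_of_nonneg (heatKernel_nonneg ht.le _)
    · simp
  let g : ℝ → ℝ := fun t => ((2 * π) ^ (d : ℝ))⁻¹ *
    ∫ ξ, Real.exp (-t * ‖ξ‖ ^ 2) * ‖fourierOn Ω u ξ‖ ^ 2
  have hg0 : ∀ t, 0 ≤ g t := fun t =>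
    mul_nonneg (by positivity) (integral_nonneg fun ξ => by positivity)
  have hgeq : ∀ᵐ t ∂(powerMeasure α), ∫ p, (heatKernel t (p.1 - p.2) : ℂ) *
      (conj (u p.2) * u p.1) ∂((volume.restrict Ω).prod (volume.restrict Ω)) = (g t : ℂ) := by
    filter_upwards [ae_powerMeasure_pos α] with t ht
    rw [← integral_heatKernel_form ht u]
    simp only [mul_assoc]
  -- Fubini provides integrability of the inner integral, which equals `g` almost everywhere.
  have hgint : Integrable g (powerMeasure α) := by
    have h1 := (hint.integral_prod_right.congr hgeq).re
    exact h1
  refine ⟨∫ t, g t ∂(powerMeasure α), integral_nonneg hg0, ?_, ?_⟩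
  · rw [← integral_complex_ofReal, ← integral_congr_ae hgeq, ← integral_integral_swap hint]
    simp only [integral_mul_const, ofReal_toReal_rieszKernel, mul_assoc]
  · have hmE : Measurable (Function.uncurry fun (t : ℝ) (ξ : EuclideanSpace ℝ (Fin d)) =>
        ENNReal.ofReal (Real.exp (-t * ‖ξ‖ ^ 2)) * ‖fourierOn Ω u ξ‖ₑ ^ 2) := by
      refine Measurable.mul ?_ (((measurable_fourierOn u).enorm.pow_const 2).comp measurable_snd)
      fun_prop
    calc ENNReal.ofReal (∫ t, g t ∂(powerMeasure α))
        = ∫⁻ t, ENNReal.ofReal (g t) ∂(powerMeasure α) :=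
          ofReal_integral_eq_lintegral_ofReal hgint (Filter.Eventually.of_forall hg0)
      _ = ∫⁻ t, ENNReal.ofReal ((2 * π) ^ (d : ℝ))⁻¹ * ∫⁻ ξ, ENNReal.ofReal
            (Real.exp (-t * ‖ξ‖ ^ 2)) * ‖fourierOn Ω u ξ‖ₑ ^ 2 ∂volume ∂(powerMeasure α) := by
          refine lintegral_congr_ae ?_
          filter_upwards [ae_powerMeasure_pos α] with t ht
          rw [ENNReal.ofReal_mul (by positivity), ofReal_integral_eq_lintegral_ofReal
            (integrable_exp_mul_fourierOn_sq ht u)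
            (Filter.Eventually.of_forall fun ξ => by positivity)]
          congr 1
          refine lintegral_congr fun ξ => ?_
          rw [ENNReal.ofReal_mul (by positivity), ENNReal.ofReal_pow (norm_nonneg _), ofReal_norm]
      _ = _ := by
          rw [lintegral_const_mul' _ _ ENNReal.ofReal_ne_top,
            lintegral_lintegral_swap hmE.aemeasurable]
          congr 1
          refine lintegral_congr_ae ?_
          filter_upwards [hne] with ξ hξ
          rw [lintegral_mul_const _ (by fun_prop), lintegral_exp_neg_sq_powerMeasure hα hξ]

end QuadraticForm

/-! ### The trace bound, its optimization and the main theorem. -/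

section EigenvalueBound

open Set
open scoped NNReal ComplexConjugate Real

variable {d : ℕ}

/-- Polar coordinates reduce this to `∫₀^R (r^{d-1-α} - R^{-α} r^{d-1}) dr`, which converges at 0
because `α < d`. -/
theorem integrable_truncated_rpow_norm {α : ℝ} (hα : 0 < α) (hαd : α < d) {R : ℝ} (hR : 0 < R) :
    Integrable (fun ξ : EuclideanSpace ℝ (Fin d) =>
      (Iio R).indicator (fun r : ℝ => r ^ (-α) - R ^ (-α)) ‖ξ‖) ∧
    ∫ ξ : EuclideanSpace ℝ (Fin d), (Iio R).indicator (fun r : ℝ => r ^ (-α) - R ^ (-α)) ‖ξ‖ =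
      (volume : Measure (EuclideanSpace ℝ (Fin d))).toSphere.real univ *
        (R ^ ((d : ℝ) - α) / (d - α) - R ^ (-α) * (R ^ (d : ℝ) / d)) := by
  have hd0 : (0 : ℝ) < d := hα.trans hαd
  have hd : 0 < d := by exact_mod_cast hd0
  have : Nonempty (Fin d) := ⟨⟨0, hd⟩⟩
  have hcast : ((d - 1 : ℕ) : ℝ) = d - 1 := by
    rw [Nat.cast_sub hd, Nat.cast_one]
  have hi1 : IntervalIntegrable (fun y : ℝ => y ^ ((d : ℝ) - 1 - α)) volume 0 R :=
    intervalIntegral.intervalIntegrable_rpow' (by linarith)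
  have hi2 : IntervalIntegrable (fun y : ℝ => R ^ (-α) * y ^ ((d : ℝ) - 1)) volume 0 R :=
    (intervalIntegral.intervalIntegrable_rpow' (by linarith)).const_mul _
  have hset : Ioi (0 : ℝ) ∩ Iio R = Ioo 0 R := rfl
  have hpt : EqOn (fun y : ℝ => y ^ (d - 1) • (Iio R).indicator
      (fun r : ℝ => r ^ (-α) - R ^ (-α)) y) ((Iio R).indicator fun y : ℝ =>
        y ^ ((d : ℝ) - 1 - α) - R ^ (-α) * y ^ ((d : ℝ) - 1)) (Ioi 0) := by
    intro y hy
    have hy0 : (0 : ℝ) < y := hy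
    by_cases hyR : y ∈ Iio R
    · simp only [indicator_of_mem hyR, smul_eq_mul]
      rw [← Real.rpow_natCast, hcast, sub_eq_add_neg _ α, Real.rpow_add hy0 _ (-α)]
      ring
    · simp only [indicator_of_notMem hyR, smul_zero]
  have hint : IntegrableOn (fun y : ℝ => y ^ ((d : ℝ) - 1 - α) - R ^ (-α) * y ^ ((d : ℝ) - 1))
      (Ioo 0 R) :=
    ((intervalIntegrable_iff_integrableOn_Ioo_of_le hR.le).1 (hi1.sub hi2))
  have hfin : Module.finrank ℝ (EuclideanSpace ℝ (Fin d)) = d := by simp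
  constructor
  · rw [integrable_fun_norm_addHaar volume, hfin, integrableOn_congr_fun hpt measurableSet_Ioi,
      IntegrableOn, integrable_indicator_iff measurableSet_Iio, IntegrableOn,
      Measure.restrict_restrict measurableSet_Iio, inter_comm, hset]
    exact hint
  · rw [integral_fun_norm_addHaar, hfin, setIntegral_congr_fun measurableSet_Ioi hpt,
      setIntegral_indicator measurableSet_Iio, hset, ← integral_Ioc_eq_integral_Ioo,
      ← intervalIntegral.integral_of_le hR.le, intervalIntegral.integral_sub hi1 hi2,
      intervalIntegral.integral_const_mul, integral_rpow (Or.inl (by linarith)),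
      integral_rpow (Or.inl (by linarith)), Measure.toSphere_real_apply_univ, hfin,
      show (d : ℝ) - 1 - α + 1 = d - α by ring, sub_add_cancel,
      Real.zero_rpow (by linarith), Real.zero_rpow hd0.ne', nsmul_eq_mul, smul_eq_mul]
    ring

/-- The trace bound: along an orthonormal family of length `n`, the quadratic forms of the Riesz
potential sum up to at most what the Fourier multiplier `|ξ|^{-α}` yields if `|ξ|^{-α} - R^{-α}` is
integrated over the ball of radius `R` against the phase space density. -/
theorem sum_form_le {α : ℝ} (hα : 0 < α) (hαd : α < d) {R : ℝ} (hR : 0 < R)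
    {Ω : Set (EuclideanSpace ℝ (Fin d))} [IsFiniteMeasure (volume.restrict Ω)] {n : ℕ}
    {v : Fin n → L2 Ω} (hv : Orthonormal ℂ v) {q : Fin n → ℝ} (hq0 : ∀ i, 0 ≤ q i)
    (hq : ∀ i, ENNReal.ofReal (q i) = ENNReal.ofReal ((2 * π) ^ (d : ℝ))⁻¹ *
      ∫⁻ ξ : EuclideanSpace ℝ (Fin d),
        ENNReal.ofReal (‖ξ‖ ^ (-α)) * ‖fourierOn Ω (v i) ξ‖ₑ ^ 2) :
    ∑ i, q i ≤ n * R ^ (-α) + ((2 * π) ^ (d : ℝ))⁻¹ * (volume.real Ω *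
      ((volume : Measure (EuclideanSpace ℝ (Fin d))).toSphere.real univ *
        (R ^ ((d : ℝ) - α) / (d - α) - R ^ (-α) * (R ^ (d : ℝ) / d)))) := by
  obtain ⟨hint, hval⟩ := integrable_truncated_rpow_norm hα hαd hR
  set f : ℝ → ℝ := (Iio R).indicator fun r : ℝ => r ^ (-α) - R ^ (-α) with hf
  have hfle : ∀ ξ : EuclideanSpace ℝ (Fin d), ‖ξ‖ ^ (-α) ≤ R ^ (-α) + f ‖ξ‖ := by
    intro ξ
    by_cases h : ‖ξ‖ ∈ Iio R
    · simp [hf, indicator_of_mem h]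
    · simp only [hf, indicator_of_notMem h, add_zero]
      exact Real.rpow_le_rpow_of_nonpos hR (not_lt.1 h) (by linarith)
  -- Only almost everywhere: the convention `0 ^ (-α) = 0` makes `f 0` negative.
  have hf0 : ∀ᵐ ξ : EuclideanSpace ℝ (Fin d), 0 ≤ f ‖ξ‖ := by
    have hd : 0 < d := by
      have : (0 : ℝ) < d := hα.trans hαd
      exact_mod_cast this
    have : Nonempty (Fin d) := ⟨⟨0, hd⟩⟩
    filter_upwards [Measure.ae_ne volume (0 : EuclideanSpace ℝ (Fin d))] with ξ hξ
    refine indicator_apply_nonneg fun h => sub_nonneg.2 ?_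
    exact Real.rpow_le_rpow_of_nonpos (norm_pos_iff.2 hξ) (le_of_lt h) (by linarith)
  set G := (volume : Measure (EuclideanSpace ℝ (Fin d))).toSphere.real univ *
        (R ^ ((d : ℝ) - α) / (d - α) - R ^ (-α) * (R ^ (d : ℝ) / d)) with hG
  have hG0 : 0 ≤ G := by
    rw [← hval]
    exact integral_nonneg_of_ae hf0
  have hGl : ∫⁻ ξ : EuclideanSpace ℝ (Fin d), ENNReal.ofReal (f ‖ξ‖) = ENNReal.ofReal G := by
    rw [← hval, ofReal_integral_eq_lintegral_ofReal hint hf0]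
  have hfm : Measurable fun ξ : EuclideanSpace ℝ (Fin d) => ENNReal.ofReal (f ‖ξ‖) := by
    have hf' : Measurable f := Measurable.indicator (by fun_prop) measurableSet_Iio
    exact (hf'.comp measurable_norm).ennreal_ofReal
  have hvm : ∀ i, Measurable fun ξ => ‖fourierOn Ω (v i) ξ‖ₑ ^ 2 := fun i =>
    (measurable_fourierOn (v i)).enorm.pow_const 2
  have hsum : ∀ ξ, ∑ i, ‖fourierOn Ω (v i) ξ‖ₑ ^ 2 ≤ ENNReal.ofReal (volume.real Ω) := by
    intro ξ
    refine le_trans (le_of_eq ?_)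
      (ENNReal.ofReal_le_ofReal (sum_norm_fourierOn_sq_le hv ξ))
    rw [ENNReal.ofReal_sum_of_nonneg fun i _ => by positivity]
    refine Finset.sum_congr rfl fun i _ => ?_
    rw [ENNReal.ofReal_pow (norm_nonneg _), ofReal_norm]
  have hterm : ∀ i, ∫⁻ ξ : EuclideanSpace ℝ (Fin d),
      ENNReal.ofReal (‖ξ‖ ^ (-α)) * ‖fourierOn Ω (v i) ξ‖ₑ ^ 2 ≤
      ENNReal.ofReal (R ^ (-α) * (2 * π) ^ (d : ℝ)) + ∫⁻ ξ : EuclideanSpace ℝ (Fin d),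
        ENNReal.ofReal (f ‖ξ‖) * ‖fourierOn Ω (v i) ξ‖ₑ ^ 2 := by
    intro i
    have hP := lintegral_fourierOn_sq_le (v i)
    rw [hv.1 i, one_pow, mul_one] at hP
    calc _ ≤ ∫⁻ ξ : EuclideanSpace ℝ (Fin d),
          (ENNReal.ofReal (R ^ (-α)) * ‖fourierOn Ω (v i) ξ‖ₑ ^ 2 +
            ENNReal.ofReal (f ‖ξ‖) * ‖fourierOn Ω (v i) ξ‖ₑ ^ 2) := by
          refine lintegral_mono fun ξ => ?_
          simp only
          rw [← add_mul]
          gcongr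
          exact (ENNReal.ofReal_le_ofReal (hfle ξ)).trans ENNReal.ofReal_add_le
      _ ≤ _ := by
          rw [lintegral_add_left ((hvm i).const_mul _), lintegral_const_mul _ (hvm i),
            ENNReal.ofReal_mul (by positivity)]
          gcongr
  have key : ENNReal.ofReal (∑ i, q i) ≤ ENNReal.ofReal (n * R ^ (-α) +
      ((2 * π) ^ (d : ℝ))⁻¹ * (volume.real Ω * G)) := by
    calc ENNReal.ofReal (∑ i, q i)
        = ENNReal.ofReal ((2 * π) ^ (d : ℝ))⁻¹ * ∑ i, ∫⁻ ξ : EuclideanSpace ℝ (Fin d),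
            ENNReal.ofReal (‖ξ‖ ^ (-α)) * ‖fourierOn Ω (v i) ξ‖ₑ ^ 2 := by
          rw [ENNReal.ofReal_sum_of_nonneg fun i _ => hq0 i, Finset.mul_sum]
          exact Finset.sum_congr rfl fun i _ => hq i
      _ ≤ ENNReal.ofReal ((2 * π) ^ (d : ℝ))⁻¹ *
            ∑ i, (ENNReal.ofReal (R ^ (-α) * (2 * π) ^ (d : ℝ)) +
              ∫⁻ ξ : EuclideanSpace ℝ (Fin d),
                ENNReal.ofReal (f ‖ξ‖) * ‖fourierOn Ω (v i) ξ‖ₑ ^ 2) := by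
          gcongr with i
          exact hterm i
      _ ≤ ENNReal.ofReal ((2 * π) ^ (d : ℝ))⁻¹ *
            (ENNReal.ofReal (n * (R ^ (-α) * (2 * π) ^ (d : ℝ))) +
              ENNReal.ofReal (volume.real Ω * G)) := by
          -- The sum is taken inside the integral before estimating: Bessel's inequality then bounds
          -- the second term independently of `n`.
          rw [Finset.sum_add_distrib, Finset.sum_const, Finset.card_univ, Fintype.card_fin,
            nsmul_eq_mul, ENNReal.ofReal_mul (Nat.cast_nonneg n), ENNReal.ofReal_natCast,
            ← lintegral_finsetSum _ fun i _ => by exact hfm.mul (hvm i),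
            ENNReal.ofReal_mul measureReal_nonneg, ← hGl,
            ← lintegral_const_mul _ hfm]
          gcongr with ξ
          rw [← Finset.mul_sum, mul_comm]
          gcongr
          exact hsum ξ
      _ = _ := by
          rw [← ENNReal.ofReal_add (by positivity)
            (mul_nonneg measureReal_nonneg hG0), ← ENNReal.ofReal_mul (by positivity)]
          congr 1
          field_simp
  have hnn : 0 ≤ n * R ^ (-α) + ((2 * π) ^ (d : ℝ))⁻¹ * (volume.real Ω * G) :=
    add_nonneg (by positivity)
      (mul_nonneg (by positivity) (mul_nonneg measureReal_nonneg hG0))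
  exact (ENNReal.ofReal_le_ofReal_iff hnn).1 key

/-- Solving the trace bound for `n` at the optimal radius. -/
theorem le_of_trace_bound {α δ lam W n : ℝ} (hα : 0 < α) (hαd : α < δ) (hlam : 0 < lam)
    (h : ∀ R : ℝ, 0 < R → n * lam ≤ n * R ^ (-α) + ((2 * π) ^ δ)⁻¹ * (W *
        (R ^ (δ - α) / (δ - α) - R ^ (-α) * (R ^ δ / δ)))) :
    n ≤ (2 * π) ^ (-δ) * lam ^ (-(δ / α)) * W *
      (δ ^ (δ / α) / (δ * (δ - α) ^ (δ / α))) := by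
  have hδ : 0 < δ := hα.trans hαd
  have hδα : 0 < δ - α := sub_pos.2 hαd
  -- The radius `R = ρ^{1/α}` minimizes `R^{δ-α} / (λ - R^{-α})`, to which the bound on `n` is
  -- proportional. It gives `R^{-α} = λ(δ-α)/δ`, leaving the fraction `α/δ` of `nλ` on the left.
  set ρ := δ / ((δ - α) * lam) with hρ
  have hρ0 : 0 < ρ := by positivity
  have hR := h (ρ ^ (1 / α)) (by positivity)
  have h1 : (ρ ^ (1 / α)) ^ (-α) = lam * (δ - α) / δ := by
    rw [← Real.rpow_mul hρ0.le, show 1 / α * -α = -1 by field_simp, Real.rpow_neg_one, hρ, inv_div]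
    ring
  have h2 : (ρ ^ (1 / α)) ^ δ = ρ ^ (δ / α) := by
    rw [← Real.rpow_mul hρ0.le, one_div_mul_eq_div]
  have h3 : (ρ ^ (1 / α)) ^ (δ - α) = ρ ^ (δ / α) * (lam * (δ - α) / δ) := by
    rw [← h1, ← h2, ← Real.rpow_add (by positivity), sub_eq_add_neg]
  have h4 : ρ ^ (δ / α) = δ ^ (δ / α) / (δ - α) ^ (δ / α) * lam ^ (-(δ / α)) := by
    rw [hρ, Real.div_rpow hδ.le (by positivity), Real.mul_rpow hδα.le hlam.le,
      Real.rpow_neg hlam.le]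
    field_simp
  rw [h3, h2, h1] at hR
  have h5 : n * (lam * α / δ) ≤
      (((2 * π) ^ δ)⁻¹ * W * ρ ^ (δ / α) / δ) * (lam * α / δ) := by
    have e1 : ((2 * π) ^ δ)⁻¹ * (W * (ρ ^ (δ / α) * (lam * (δ - α) / δ) / (δ - α) -
        lam * (δ - α) / δ * (ρ ^ (δ / α) / δ))) =
        (((2 * π) ^ δ)⁻¹ * W * ρ ^ (δ / α) / δ) * (lam * α / δ) := by
      field_simp
      ring
    have e2 : n * (lam * α / δ) = n * lam - n * (lam * (δ - α) / δ) := by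
      field_simp
      ring
    rw [e2, ← e1]
    linarith
  refine (le_of_mul_le_mul_right h5 (by positivity)).trans (le_of_eq ?_)
  rw [h4, Real.rpow_neg (show 0 ≤ 2 * π by positivity) δ]
  field_simp

theorem eigenvalue_re_nonneg_im_eq_zero {H : Type*} [NormedAddCommGroup H]
    [InnerProductSpace ℂ H] {T : H →L[ℂ] H} (hT : T.IsPositive) {μ : ℂ}
    (hμ : Module.End.HasEigenvalue (T : H →ₗ[ℂ] H) μ) : 0 ≤ μ.re ∧ μ.im = 0 := by
  have him : μ.im = 0 := Complex.conj_eq_iff_im.1 (hT.isSymmetric.conj_eigenvalue_eq_self hμ)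
  obtain ⟨v, hv⟩ := hμ.exists_hasEigenvector
  have heig : T v = μ • v := hv.apply_eq_smul
  have h := hT.re_inner_nonneg_left v
  have hpos : 0 < ‖v‖ ^ 2 := by
    have := norm_pos_iff.2 hv.2
    positivity
  rw [heig, inner_smul_left, inner_self_eq_norm_sq_to_K] at h
  have h2 : 0 ≤ μ.re * ‖v‖ ^ 2 := by
    have e : RCLike.re (conj μ * ((‖v‖ : ℂ)) ^ 2) = μ.re * ‖v‖ ^ 2 := by
      rw [← Complex.ofReal_pow, RCLike.re_to_complex, Complex.re_mul_ofReal, Complex.conj_re]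
    exact e ▸ h
  exact ⟨nonneg_of_mul_nonneg_left h2 hpos, him⟩

end EigenvalueBound

theorem mainTheorem4 (d : ℕ) (α : ℝ) (hα : 0 < α) (hαd : α < d)
    (Ω : Set (EuclideanSpace ℝ (Fin d))) (hΩ : IsOpen Ω) (hΩfin : volume Ω < ∞)
    (K : EuclideanSpace ℝ (Fin d) → ℂ)
    (hK : HasDistribFourier K (fun ξ => ((‖ξ‖ ^ (-α) : ℝ) : ℂ))) :
    ∃ T : L2 Ω →L[ℂ] L2 Ω,
      IsConvolutionOperator K Ω T ∧
      IsCompactOperator T ∧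
      T.IsPositive ∧
      (∀ μ : ℂ, Module.End.HasEigenvalue (T : L2 Ω →ₗ[ℂ] L2 Ω) μ → 0 ≤ μ.re ∧ μ.im = 0) ∧
      ∀ lam : ℝ, 0 < lam →
        eigenvalueCount T lam ≤ ENNReal.ofReal
          ((2 * Real.pi) ^ (-(d : ℝ)) * lam ^ (-((d : ℝ) / α)) * volume.real Ω *
            (volume : Measure (EuclideanSpace ℝ (Fin d))).toSphere.real Set.univ *
            ((d : ℝ) ^ ((d : ℝ) / α) / ((d : ℝ) * ((d : ℝ) - α) ^ ((d : ℝ) / α)))) := by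
  have : IsFiniteMeasure (volume.restrict Ω) := ⟨by simpa using hΩfin⟩
  obtain ⟨M, hM⟩ := exists_setLIntegral_rieszKernel_sub_le hα hαd hΩ.measurableSet hΩfin
  have hm : Measurable (Function.uncurry fun x y : EuclideanSpace ℝ (Fin d) =>
      (rieszKernel α (x - y)).toReal) :=
    ((measurable_rieszKernel α).comp (measurable_fst.sub measurable_snd)).ennreal_toReal
  have hsymm : ∀ x y : EuclideanSpace ℝ (Fin d),
      (rieszKernel α (x - y)).toReal = (rieszKernel α (y - x)).toReal := fun x y => by
    rw [← rieszKernel_neg, neg_sub]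
  have hM' : ∀ x, ∫⁻ y in Ω, ‖(rieszKernel α (x - y)).toReal‖ₑ ≤ M := fun x => by
    refine le_trans (lintegral_mono fun y => ?_) (hM x)
    rw [Real.enorm_of_nonneg ENNReal.toReal_nonneg]
    exact ENNReal.ofReal_toReal_le
  obtain ⟨T, -, hT⟩ := exists_kernelOperator hm hsymm hM'
  have hform : ∀ u : L2 Ω, ∃ q : ℝ, 0 ≤ q ∧ inner ℂ (T u) u = (q : ℂ) ∧
      ENNReal.ofReal q = ENNReal.ofReal ((2 * Real.pi) ^ (d : ℝ))⁻¹ *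
        ∫⁻ ξ : EuclideanSpace ℝ (Fin d),
          ENNReal.ofReal (‖ξ‖ ^ (-α)) * ‖fourierOn Ω u ξ‖ₑ ^ 2 := fun u => by
    rw [inner_kernelOperator hm hsymm hM' ((hT u).mono fun _ h => h.2)]
    exact rieszKernel_form hα hαd hM u
  choose q hq0 hq hqF using hform
  have hre : ∀ u, (inner ℂ (T u) u).re = q u := fun u => by rw [hq, Complex.ofReal_re]
  have hpos : T.IsPositive := by
    rw [ContinuousLinearMap.isPositive_iff_complex]
    intro u
    simp only [RCLike.re_to_complex, hre]
    exact ⟨(hq u).symm, hq0 u⟩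
  have htrace : ∀ (R : ℝ), 0 < R → ∀ (n : ℕ) (v : Fin n → L2 Ω), Orthonormal ℂ v → _ :=
    fun R hR n v hv => sum_form_le hα hαd hR hv (fun i => hq0 (v i)) fun i => hqF (v i)
  have hcomp : IsCompactOperator T := by
    refine isCompactOperator_of_sum_re_inner_le hpos fun s hs => ?_
    -- This radius satisfies `R^{-α} = s`, so the trace bound has slope `s` in `n`.
    have hs' : (s ^ (-(1 / α))) ^ (-α) = s := by
      rw [← Real.rpow_mul hs.le, neg_mul_neg, one_div_mul_cancel hα.ne', Real.rpow_one]
    have h := htrace (s ^ (-(1 / α))) (by positivity)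
    simp only [hs'] at h
    exact ⟨_, fun n v hv => (Finset.sum_congr rfl fun i _ => hre _).trans_le (h n v hv)⟩
  refine ⟨T, fun u => ?_, hcomp, hpos, fun μ hμ => eigenvalue_re_nonneg_im_eq_zero hpos hμ,
    fun lam hlam => ?_⟩
  · filter_upwards [hT u] with x hx
    have hKx : (fun y => K (x - y) * u y) =ᵐ[volume.restrict Ω]
        fun y => ((rieszKernel α (x - y)).toReal : ℂ) * u y := by
      -- The map `y ↦ x - y` preserves null sets, so for every `x` the kernel `K` can be replaced by
      -- the Riesz kernel inside the integral.
      have h := (Measure.measurePreserving_sub_left volume x).quasiMeasurePreserving.ae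
        (hK.ae_eq_rieszKernel hα hαd)
      filter_upwards [ae_restrict_of_ae h] with y hy
      rw [hy]
    exact ⟨hx.1.congr hKx.symm, hx.2.trans (integral_congr_ae hKx).symm⟩
  · refine eigenvalueCount_le_ofReal hpos hcomp hlam fun n v hv hlv => ?_
    rw [mul_assoc _ (volume.real Ω)]
    refine le_of_trace_bound hα hαd hlam fun R hR => ?_
    have h1 : (n : ℝ) * lam ≤ ∑ i, q (v i) := by
      simpa [hre] using Finset.sum_le_sum fun i (_ : i ∈ Finset.univ) => hlv i
    rw [mul_assoc (volume.real Ω)]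
    exact h1.trans (htrace R hR n v hv)
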